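/- Let $d\ge 1$ be an integer, $\beta\ge 1$ and $K>0$ real numbers, and $m=\lfloor\beta\rfloor$. Let $\mathcal H^\beta_K(\mathbb R^d,\mathbb R)$ be the set of functions $f:\mathbb R^d\to\mathbb R$ with $$\sum_{|\nu|\le m}\|\partial^\nu f\|_{L^\infty}+\sum_{|\nu|=m}\ \sup_{x\ne y}\frac{|\partial^\nu f(x)-\partial^\nu f(y)|}{\|x-y\|^{\beta-m}}\le K ,$$ where $f$ is $m$ times continuously differentiable if $\beta\notin\mathbb N$, and where, if $\beta=m$, $f$ is only required to be $C^{m-1}$ with Lipschitz derivatives of order $m-1$ (so that the derivatives of order $m$ exist almost everywhere, and the suprema are taken over the points at which they exist). There is a constant $C>0$, depending only on $d$, $\beta$ and $K$, such that the following holds. Let $$p(x)=\exp\left(-\frac{\|x\|^2}{2}+a(x)\right),\qquad a\in\mathcal H^\beta_K(\mathbb R^d,\mathbb R),$$ be a probability density on $\mathbb R^d$. For $t>0$ let $\mu_t$ be the law at time $t$ of the Ornstein–Uhlenbeck process $dY_t=-Y_t\,dt+\sqrt2\,dB_t$, $Y_0\sim p$, that is, the law of $e^{-t}X+\sqrt{1-e^{-2t}}\,Z$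 with $X\sim p$ and an independent standard Gaussian vector $Z$, and let $s(t,x)=\nabla\log\mu_t(x)$ be its score (where $\mu_t(\cdot)$ is the continuous density). Then for every $t>0$ the map $s(t,\cdot)$ is of class $C^{m+1}$, and, with operator norms of the differentials $\nabla^k$ in $x$, $$\sum_{k=0}^{m}\ \sup_{x\in\mathbb R^d}\bigl\|\nabla^k\bigl(s(t,x)+x\bigr)\bigr\|\le C e^{-t}\bigl(1+t^{-1/2}\bigr),$$ $$\sup_{x\in\mathbb R^d}\bigl\|\nabla^{m+1}s(t,x)\bigr\|\le C e^{-t}\bigl(1+t^{(\beta-m)/2-1}\bigr).$$ Moreover, for $0<t<1$, $$\sum_{k=1}^{m}\ \sup_{x\in\mathbb R^d}\bigl\|\nabla^k s(t,x)\bigr\|\le C e^{-t}\bigl(1+t^{-1/2}\bigr).$$ -/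

import Mathlib

open MeasureTheory ProbabilityTheory
open scoped ENNReal NNReal Gradient

noncomputable section

namespace OUScore

/-- `ℝ^d` with its Euclidean norm. -/
abbrev E (d : ℕ) : Type := EuclideanSpace ℝ (Fin d)

/-- The list of coordinate directions in which `∂^ν` differentiates: the index `i` is repeated
`ν i` times. Its length is `|ν|`. -/
def dirs {d : ℕ} (ν : Fin d → ℕ) : List (Fin d) :=
  (List.finRange d).flatMap fun i => List.replicate (ν i) i

/-- The partial derivative `∂^ν f (x) = ∂^{|ν|} f / (∂x_1^{ν_1} ⋯ ∂x_d^{ν_d}) (x)`. -/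
def pderiv {d : ℕ} (ν : Fin d → ℕ) (f : E d → ℝ) (x : E d) : ℝ :=
  iteratedFDeriv ℝ (dirs ν).length f x
    fun j => EuclideanSpace.single ((dirs ν).get j) (1 : ℝ)

/-- The points at which `f` has derivatives of all orders up to `m`. -/
def diffPoints {d : ℕ} (m : ℕ) (f : E d → ℝ) : Set (E d) :=
  {x | ∀ k < m, DifferentiableAt ℝ (iteratedFDeriv ℝ k f) x}

/-- The qualitative regularity of a function of Hölder order `η ≥ 1`, with `m = ⌊η⌋`:
if `η` is not an integer, `f` is `C^m`; if `η = m`, then `f` is `C^{m-1}` and its derivative of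
order `m - 1` is Lipschitz, so that the derivatives of order `m` exist almost everywhere (this
includes every `C^m` function with bounded derivatives of order `m`). -/
def HolderRegular {d : ℕ} (η : ℝ) (f : E d → ℝ) : Prop :=
  (η ≠ ⌊η⌋₊ → ContDiff ℝ ⌊η⌋₊ f) ∧
  (η = ⌊η⌋₊ → ContDiff ℝ (⌊η⌋₊ - 1 : ℕ) f ∧
    ∃ L : ℝ≥0, LipschitzWith L (iteratedFDeriv ℝ (⌊η⌋₊ - 1) f))

/-- The Hölder seminorm `sup_{x ≠ y} |∂^ν f(x) - ∂^ν f(y)| / ‖x - y‖^(η - ⌊η⌋)`, over the points at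
which `f` is `⌊η⌋` times differentiable (all points, if `f` is `C^⌊η⌋`). -/
def holderSeminorm {d : ℕ} (η : ℝ) (ν : Fin d → ℕ) (f : E d → ℝ) : ℝ≥0∞ :=
  ⨆ x ∈ diffPoints ⌊η⌋₊ f, ⨆ y ∈ diffPoints ⌊η⌋₊ f, ⨆ _ : x ≠ y,
    ‖pderiv ν f x - pderiv ν f y‖ₑ / ENNReal.ofReal (‖x - y‖ ^ (η - ⌊η⌋₊))

/-- The Hölder norm: the sum of the `L^∞` norms of all `∂^ν f` with `|ν| ≤ ⌊η⌋` and of the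
`(η - ⌊η⌋)`-Hölder seminorms of those with `|ν| = ⌊η⌋`. -/
def holderNorm {d : ℕ} (η : ℝ) (f : E d → ℝ) : ℝ≥0∞ :=
  (∑ k ∈ Finset.range (⌊η⌋₊ + 1), ∑ ν ∈ Finset.piAntidiag (Finset.univ : Finset (Fin d)) k,
      eLpNorm (pderiv ν f) ∞ volume) +
    ∑ ν ∈ Finset.piAntidiag (Finset.univ : Finset (Fin d)) ⌊η⌋₊, holderSeminorm η ν f

/-- The ball `H^η_K(ℝ^d, ℝ)` of radius `K` of the Hölder space of order `η ≥ 1`. -/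
def holderBall (d : ℕ) (η K : ℝ) : Set (E d → ℝ) :=
  {f | HolderRegular η f ∧ holderNorm η f ≤ ENNReal.ofReal K}

/-- The function `p(x) = exp(-‖x‖²/2 + a(x))`. -/
def target {d : ℕ} (a : E d → ℝ) (x : E d) : ℝ :=
  Real.exp (-‖x‖ ^ 2 / 2 + a x)

/-- The law `μ_t` at time `t` of the Ornstein-Uhlenbeck process `dY = -Y dt + √2 dB` with
`Y_0 ∼ p`, that is, the law of `e^{-t} X + √(1 - e^{-2t}) Z` with `X ∼ p` and a standard Gaussian
vector `Z` independent of `X`. -/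
def ouLaw {d : ℕ} (a : E d → ℝ) (t : ℝ) : Measure (E d) :=
  ((volume.withDensity fun x => ENNReal.ofReal (target a x)).prod (stdGaussian (E d))).map
    fun w => Real.exp (-t) • w.1 + √(1 - Real.exp (-2 * t)) • w.2

/-- The density of the centered Gaussian law on `ℝ^d` with covariance `v • Id`. -/
def gaussDensity (d : ℕ) (v : ℝ) (x : E d) : ℝ :=
  (√(2 * Real.pi * v) ^ d)⁻¹ * Real.exp (-‖x‖ ^ 2 / (2 * v))

/-- The density of `μ_t` for `t > 0` (see `ouLaw_eq_withDensity`). -/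
def ouDensity {d : ℕ} (a : E d → ℝ) (t : ℝ) (x : E d) : ℝ :=
  ∫ y, target a y * gaussDensity d (1 - Real.exp (-2 * t)) (x - Real.exp (-t) • y)

lemma gaussDensity_nonneg (d : ℕ) (v : ℝ) (x : E d) : 0 ≤ gaussDensity d v x := by
  unfold gaussDensity; positivity

lemma continuous_gaussDensity (d : ℕ) (v : ℝ) : Continuous (gaussDensity d v) := by
  unfold gaussDensity; fun_prop

lemma integrable_gaussDensity (d : ℕ) : Integrable (gaussDensity d 1) := by
  have h := GaussianFourier.integral_rexp_neg_mul_sq_norm (V := E d) (b := 1 / 2) (by norm_num)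
  have h2 : Integrable fun x : E d => Real.exp (-(1 / 2) * ‖x‖ ^ 2) := by
    apply Integrable.of_integral_ne_zero
    rw [h]; positivity
  convert h2.const_mul (√(2 * Real.pi * 1) ^ d)⁻¹ using 4
  unfold gaussDensity
  congr 2; ring

lemma stdGaussian_eq_withDensity (d : ℕ) :
    stdGaussian (E d) = volume.withDensity fun x => ENNReal.ofReal (gaussDensity d 1 x) := by
  have : IsFiniteMeasure (volume.withDensity fun x => ENNReal.ofReal (gaussDensity d 1 x)) :=
    isFiniteMeasure_withDensity_ofReal (integrable_gaussDensity d).2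
  apply Measure.ext_of_charFun
  ext t
  rw [charFun_stdGaussian, charFun_apply,
    integral_withDensity_eq_integral_toReal_smul
      (continuous_gaussDensity d 1).measurable.ennreal_ofReal (by simp)]
  have h := GaussianFourier.integral_cexp_neg_mul_sq_norm_add (V := E d) (b := 1 / 2)
    (by norm_num) Complex.I t
  have hc : ∀ x : E d, (ENNReal.ofReal (gaussDensity d 1 x)).toReal •
      Complex.exp (↑(inner ℝ x t) * Complex.I) =
      ((√(2 * Real.pi) ^ d)⁻¹ : ℝ) *
        Complex.exp (-(1 / 2) * ↑‖x‖ ^ 2 + Complex.I * ↑(inner ℝ t x)) := by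
    intro x
    rw [ENNReal.toReal_ofReal (gaussDensity_nonneg d 1 x), Complex.exp_add, Complex.real_smul]
    unfold gaussDensity
    rw [real_inner_comm]
    push_cast
    rw [mul_assoc]
    congr 3
    · simp
    · ring
    · ring
  simp_rw [hc]
  rw [integral_const_mul, h]
  have hp : ((Real.pi : ℂ) / (1 / 2)) ^ ((Module.finrank ℝ (E d) : ℂ) / 2) =
      ((√(2 * Real.pi) ^ d : ℝ) : ℂ) := by
    rw [Real.sqrt_eq_rpow, ← Real.rpow_mul_natCast (by positivity),
      Complex.ofReal_cpow (by positivity)]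
    simp
    congr 1 <;> ring
  have hne : (√(2 * Real.pi) ^ d) ≠ 0 := by positivity
  rw [hp, ← mul_assoc, ← Complex.ofReal_mul, inv_mul_cancel₀ hne]
  simp
  congr 1
  ring

/-- `ouDensity a t` is the density of the law `μ_t` of the Ornstein-Uhlenbeck process. -/
theorem ouLaw_eq_withDensity {d : ℕ} (a : E d → ℝ) (ha : Measurable a)
    (hp : Integrable (target a)) (t : ℝ) (ht : 0 < t) :
    ouLaw a t = volume.withDensity fun x => ENNReal.ofReal (ouDensity a t x) := by
  have hv : 0 < 1 - Real.exp (-2 * t) := by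
    have : Real.exp (-2 * t) < 1 := Real.exp_lt_one_iff.2 (by linarith)
    linarith
  set v := 1 - Real.exp (-2 * t) with hvdef
  set c := Real.exp (-t)
  have hsv : 0 < √v := Real.sqrt_pos.2 hv
  have hm : Measurable (target a) := by unfold target; fun_prop
  have hg : ∀ w, Measurable (gaussDensity d w) := fun w => (continuous_gaussDensity d w).measurable
  have hpn : ∀ y, 0 ≤ target a y := fun y => (Real.exp_pos _).le
  -- the one-point transition density
  have hscale : ∀ z : E d, gaussDensity d 1 ((√v)⁻¹ • z) = √v ^ d * gaussDensity d v z := by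
    intro z
    unfold gaussDensity
    rw [norm_smul, Real.sqrt_mul (by positivity) v, mul_pow, mul_pow]
    simp only [mul_one, norm_inv, Real.norm_eq_abs, abs_of_pos hsv, inv_pow, Real.sq_sqrt hv.le]
    field_simp
  have htrans : ∀ (f : E d → ℝ≥0∞), Measurable f → ∀ y : E d,
      ∫⁻ z, f (c • y + √v • z) ∂(stdGaussian (E d)) =
        ∫⁻ x, ENNReal.ofReal (gaussDensity d v (x - c • y)) * f x := by
    intro f hf y
    rw [stdGaussian_eq_withDensity,
      lintegral_withDensity_eq_lintegral_mul _ (hg 1).ennreal_ofReal (by fun_prop)]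
    simp only [Pi.mul_apply]
    rw [← lintegral_add_left_eq_self (μ := volume)
      (fun x => ENNReal.ofReal (gaussDensity d v (x - c • y)) * f x) (c • y)]
    simp only [add_sub_cancel_left]
    have hmap := Measure.map_addHaar_smul (volume : Measure (E d)) hsv.ne'
    have h1 : ∫⁻ z : E d, ENNReal.ofReal (gaussDensity d 1 z) * f (c • y + √v • z) =
        ∫⁻ w, ENNReal.ofReal (gaussDensity d 1 ((√v)⁻¹ • w)) * f (c • y + w)
          ∂(Measure.map (√v • ·) (volume : Measure (E d))) := by
      rw [lintegral_map (by fun_prop) (by fun_prop)]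
      simp [smul_smul, hsv.ne']
    rw [h1, hmap, lintegral_smul_measure, smul_eq_mul, ← lintegral_const_mul _ (by fun_prop)]
    congr 1 with w
    rw [hscale, ← mul_assoc, ← ENNReal.ofReal_mul (abs_nonneg _)]
    congr 2
    rw [abs_of_pos (by positivity)]
    simp only [finrank_euclideanSpace, Fintype.card_fin]
    field_simp
  -- the density as a lower Lebesgue integral
  have hbd : ∀ z : E d, gaussDensity d v z ≤ (√(2 * Real.pi * v) ^ d)⁻¹ := by
    intro z
    unfold gaussDensity
    refine mul_le_of_le_one_right (by positivity) (Real.exp_le_one_iff.2 ?_)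
    exact div_nonpos_of_nonpos_of_nonneg (by nlinarith [sq_nonneg ‖z‖]) (by positivity)
  have hden : ∀ x, ENNReal.ofReal (ouDensity a t x) =
      ∫⁻ y, ENNReal.ofReal (target a y) * ENNReal.ofReal (gaussDensity d v (x - c • y)) := by
    intro x
    unfold ouDensity
    rw [ofReal_integral_eq_lintegral_ofReal]
    · simp_rw [ENNReal.ofReal_mul (hpn _)]; rfl
    · refine hp.mul_bdd (c := (√(2 * Real.pi * v) ^ d)⁻¹)
        ((hg v).comp (by fun_prop)).aestronglyMeasurable (ae_of_all _ fun y => ?_)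
      rw [Real.norm_of_nonneg (gaussDensity_nonneg _ _ _)]
      exact hbd _
    · exact ae_of_all _ fun y => mul_nonneg (hpn y) (gaussDensity_nonneg _ _ _)
  have hmeas : Measurable fun q : E d × E d =>
      ENNReal.ofReal (target a q.2) * ENNReal.ofReal (gaussDensity d v (q.1 - c • q.2)) := by
    fun_prop
  apply Measure.ext_of_lintegral
  intro f hf
  have hdm : Measurable fun x => ENNReal.ofReal (ouDensity a t x) := by
    simp_rw [hden]
    exact hmeas.lintegral_prod_right'
  unfold ouLaw
  rw [lintegral_map hf (by fun_prop), lintegral_prod _ (by fun_prop)]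
  refine (lintegral_congr (htrans f hf)).trans ?_
  rw [lintegral_withDensity_eq_lintegral_mul _ hm.ennreal_ofReal
      (Measurable.lintegral_prod_right' (f := fun q : E d × E d =>
        ENNReal.ofReal (gaussDensity d v (q.2 - c • q.1)) * f q.2) (by fun_prop)),
    lintegral_withDensity_eq_lintegral_mul _ hdm hf]
  simp only [Pi.mul_apply, hden]
  have e1 : ∀ y, ENNReal.ofReal (target a y) *
      ∫⁻ x, ENNReal.ofReal (gaussDensity d v (x - c • y)) * f x =
      ∫⁻ x, ENNReal.ofReal (target a y) *
        (ENNReal.ofReal (gaussDensity d v (x - c • y)) * f x) := fun y =>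
    (lintegral_const_mul _ (by fun_prop)).symm
  simp_rw [e1]
  rw [lintegral_lintegral_swap (by fun_prop)]
  congr 1 with x
  rw [← lintegral_mul_const _ (by fun_prop)]
  congr 1 with y
  rw [mul_assoc]

/-- The score `s(t, x) = ∇ log μ_t(x)`. -/
def score {d : ℕ} (a : E d → ℝ) (t : ℝ) (x : E d) : E d :=
  ∇ (fun y => Real.log (ouDensity a t y)) x

end OUScore

end

/-!
With `c = e^{-t}` and `v = 1 - c²`, completing the square in the transition density gives
`μ_t(x) = e^{-‖x‖²/2} U(c x)`, where `U = P_v e^a` and `P_v` is the heat semigroup at variance `v`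
(`ouDensity_eq`). Hence `s(t, x) + x = c ∇(log U)(c x)` (`score_add_self_eq`), and everything reduces
to bounds on the derivatives of `log U` in terms of `v`, which is comparable to `min(t, 1)`.

Write `β = n + α` with `α ∈ (0, 1]`, so that an integer `β` is `(β - 1) + 1`. The Hölder ball then
consists of functions whose differentials up to order `n` are bounded and whose differential of
order `n` is `α`-Hölder (`exists_holderBounded_of_mem_holderBall`). For an integer `β` the point is
to bound the Lipschitz constant of the differential of order `β - 1` by the almost everywhere
bound on the next one; this is done on the smooth functions `P_v a`, with Rademacher's theorem and
`v → 0` (`norm_iteratedFDeriv_sub_le_of_ae`). These bounds pass from `a` to `e^a`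
(`exists_holderBounded_exp`).

The gradient of `P_v H` is `v^{-1/2} 𝔼[Z ⊗ H(x + √v Z)]`, so it is of order `v^{(α-1)/2}` when `H` is
`α`-Hölder (`norm_heatGrad_le`). As `P_v = P_{v/2} P_{v/2}` and `P_v` commutes with differentiation,
each further derivative costs a factor `v^{-1/2}`, and the derivative of order `k` of `U` is at most
of order `w_k = v^{-(k-β)⁺/2}` (`exists_norm_iteratedFDeriv_heat_le_heatWeight`).

These weights satisfy `w_i w_j ≤ w_{i+j}`, as `v ≤ 1`. So the Leibniz rule, applied to
`∇ L = e^{-L} ∇ e^L`, shows by induction on the order that `L = log U` obeys bounds with the same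
weights (`exists_norm_iteratedFDeriv_le_of_exp`). The theorem reads off `w_{k+1} ≤ v^{-1/2}` for
`k ≤ ⌊β⌋`, and the value of `w_{⌊β⌋+2}`.
-/

namespace OUScore

/-! ### Gaussian averages and their first derivative -/

section GaussianAverage

variable {d : ℕ} {F : Type} [NormedAddCommGroup F] [NormedSpace ℝ F]

-- A shortcut: the search through the second type, a space of linear maps, is expensive.
instance secondCountableTopologyEither_E (G : Type) [TopologicalSpace G] :
    SecondCountableTopologyEither (E d) G :=
  secondCountableTopologyEither_of_left _ _

lemma integral_stdGaussian_eq (H : E d → F) :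
    ∫ z, H z ∂(stdGaussian (E d)) = ∫ z, gaussDensity d 1 z • H z := by
  rw [stdGaussian_eq_withDensity, integral_withDensity_eq_integral_toReal_smul
    (continuous_gaussDensity d 1).measurable.ennreal_ofReal (by simp)]
  simp only [ENNReal.toReal_ofReal (gaussDensity_nonneg d 1 _)]

lemma integral_stdGaussian_add_eq (H : E d → F) (x : E d) :
    ∫ z, H (x + z) ∂(stdGaussian (E d)) = ∫ y, gaussDensity d 1 (y - x) • H y := by
  rw [integral_stdGaussian_eq, ← integral_sub_right_eq_self (μ := volume) _ x]
  simp

lemma hasFDerivAt_gaussDensity_one (z : E d) :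
    HasFDerivAt (gaussDensity d 1) (-(gaussDensity d 1 z) • innerSL ℝ z) z := by
  have h1 : HasFDerivAt (fun x : E d => -‖x‖ ^ 2 / (2 * 1)) (-innerSL ℝ z) z := by
    have h := ((hasStrictFDerivAt_norm_sq z).hasFDerivAt.const_mul (-(1 / 2) : ℝ))
    convert! h using 1
    · ext x; ring
    · ext x; simp
  have h2 := (h1.exp).const_mul (√(2 * Real.pi * 1) ^ d)⁻¹
  convert! h2 using 1
  ext x
  simp [gaussDensity]
  ring

lemma integrable_exp_neg_mul_sq_norm {b : ℝ} (hb : 0 < b) :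
    Integrable fun x : E d => Real.exp (-b * ‖x‖ ^ 2) := by
  apply Integrable.of_integral_ne_zero
  rw [GaussianFourier.integral_rexp_neg_mul_sq_norm (V := E d) hb]
  positivity

lemma gaussDensity_one_le (z : E d) : gaussDensity d 1 z ≤ (√(2 * Real.pi) ^ d)⁻¹ *
    Real.exp (-‖z‖ ^ 2 / 2) := by
  simp [gaussDensity]

/-- A domination of `z ↦ ‖z‖ φ(z)`, uniform under unit shifts of `z`, that serves to differentiate
under the integral sign. -/
lemma gaussDensity_one_mul_norm_le {w w₀ : E d} (h : ‖w - w₀‖ ≤ 1) :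
    gaussDensity d 1 w * ‖w‖ ≤ (√(2 * Real.pi) ^ d)⁻¹ * Real.exp (1 / 4) *
      Real.exp (-(1 / 8) * ‖w₀‖ ^ 2) := by
  have h1 : ‖w‖ ≤ Real.exp (‖w‖ ^ 2 / 4) :=
    le_trans (by nlinarith [sq_nonneg (1 - ‖w‖ / 2)]) (Real.add_one_le_exp _)
  have h2 : ‖w₀‖ ^ 2 / 2 ≤ ‖w‖ ^ 2 + 1 := by
    have : ‖w₀‖ ≤ ‖w‖ + 1 := by
      have := norm_sub_norm_le w₀ w
      rw [norm_sub_rev] at this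
      linarith
    nlinarith [sq_nonneg (‖w‖ - 1), norm_nonneg w₀, norm_nonneg w]
  calc gaussDensity d 1 w * ‖w‖
      ≤ ((√(2 * Real.pi) ^ d)⁻¹ * Real.exp (-‖w‖ ^ 2 / 2)) * Real.exp (‖w‖ ^ 2 / 4) := by
        gcongr
        exact gaussDensity_one_le w
    _ = (√(2 * Real.pi) ^ d)⁻¹ * Real.exp (-‖w‖ ^ 2 / 4) := by
        rw [mul_assoc, ← Real.exp_add]; congr 2; ring
    _ ≤ (√(2 * Real.pi) ^ d)⁻¹ * Real.exp (1 / 4 + -(1 / 8) * ‖w₀‖ ^ 2) := by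
        gcongr; linarith
    _ = _ := by rw [Real.exp_add]; ring

/-- The derivative of a Gaussian average falls on the Gaussian density, so that the averaged
function need only be bounded and continuous. -/
lemma hasFDerivAt_integral_stdGaussian_add {H : E d → F} (hH : Continuous H) {M : ℝ}
    (hM : ∀ x, ‖H x‖ ≤ M) (x : E d) :
    HasFDerivAt (fun x => ∫ z, H (x + z) ∂(stdGaussian (E d)))
      (∫ z, (innerSL ℝ z).smulRight (H (x + z)) ∂(stdGaussian (E d))) x := by
  have e1 : (fun x => ∫ z, H (x + z) ∂(stdGaussian (E d))) =
      fun x => ∫ y, gaussDensity d 1 (y - x) • H y :=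
    funext fun x => integral_stdGaussian_add_eq H x
  have e2 : ∫ z, (innerSL ℝ z).smulRight (H (x + z)) ∂(stdGaussian (E d)) =
      ∫ y, gaussDensity d 1 (y - x) • (innerSL ℝ (y - x)).smulRight (H y) := by
    have := integral_stdGaussian_add_eq (fun y => (innerSL ℝ (y - x)).smulRight (H y)) x
    simpa using this
  have hM0 : 0 ≤ M := (norm_nonneg _).trans (hM 0)
  have hcφ := continuous_gaussDensity d 1
  rw [e1, e2]
  refine hasFDerivAt_integral_of_dominated_of_fderiv_le
    (F' := fun x y => gaussDensity d 1 (y - x) • (innerSL ℝ (y - x)).smulRight (H y))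
    (bound := fun y => (√(2 * Real.pi) ^ d)⁻¹ * Real.exp (1 / 4) *
      Real.exp (-(1 / 8) * ‖y - x‖ ^ 2) * M)
    (Metric.closedBall_mem_nhds x one_pos) ?_ ?_ ?_ ?_ ?_ ?_
  · exact Filter.Eventually.of_forall fun x =>
      (show Continuous fun y => gaussDensity d 1 (y - x) • H y by fun_prop).aestronglyMeasurable
  · exact ((integrable_gaussDensity d).comp_sub_right x).smul_bdd M hH.aestronglyMeasurable
      (ae_of_all _ hM)
  · refine Continuous.aestronglyMeasurable ?_
    fun_prop
  · refine ae_of_all _ fun y x' hx' => ?_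
    have hx'' : ‖(y - x') - (y - x)‖ ≤ 1 := by
      rw [sub_sub_sub_cancel_left, ← dist_eq_norm, dist_comm]
      exact Metric.mem_closedBall.1 hx'
    calc ‖gaussDensity d 1 (y - x') • (innerSL ℝ (y - x')).smulRight (H y)‖
        = (gaussDensity d 1 (y - x') * ‖y - x'‖) * ‖H y‖ := by
          rw [norm_smul, ContinuousLinearMap.norm_smulRight_apply, innerSL_apply_norm,
            Real.norm_of_nonneg (gaussDensity_nonneg _ _ _), mul_assoc]
      _ ≤ _ :=
          mul_le_mul (gaussDensity_one_mul_norm_le hx'') (hM y) (norm_nonneg _) (by positivity)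
  · have h := (integrable_exp_neg_mul_sq_norm (d := d) (b := 1 / 8) (by norm_num)).comp_sub_right x
    exact (h.const_mul _).mul_const _
  · refine ae_of_all _ fun y x' _ => ?_
    have h1 : HasFDerivAt (fun x' => gaussDensity d 1 (y - x'))
        ((-(gaussDensity d 1 (y - x')) • innerSL ℝ (y - x')).comp
          (-ContinuousLinearMap.id ℝ (E d))) x' :=
      (hasFDerivAt_gaussDensity_one (y - x')).comp x' ((hasFDerivAt_id x').const_sub y)
    convert! h1.smul_const (H y) using 1
    ext w
    simp [smul_smul]

/-- The Gaussian average `P_v H (x) = 𝔼 H(x + √v Z)`, with `Z` a standard Gaussian vector: the heat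
semigroup on `ℝ^d`, at variance `v`. -/
noncomputable def heat (v : ℝ) (H : E d → F) (x : E d) : F :=
  ∫ z, H (x + √v • z) ∂(stdGaussian (E d))

/-- The gradient of `heat v H`, written `v^{-1/2} 𝔼 [Z ⊗ H(x + √v Z)]`. -/
noncomputable def heatGrad (v : ℝ) (H : E d → F) (x : E d) : E d →L[ℝ] F :=
  (√v)⁻¹ • ∫ z, (innerSL ℝ z).smulRight (H (x + √v • z)) ∂(stdGaussian (E d))

lemma hasFDerivAt_heat {v : ℝ} (hv : 0 < v) {H : E d → F} (hH : Continuous H) {M : ℝ}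
    (hM : ∀ x, ‖H x‖ ≤ M) (x : E d) : HasFDerivAt (heat v H) (heatGrad v H x) x := by
  have hs : √v ≠ 0 := (Real.sqrt_pos.2 hv).ne'
  have h1 := hasFDerivAt_integral_stdGaussian_add (H := fun y => H (√v • y)) (by fun_prop)
    (fun x => hM _) ((√v)⁻¹ • x)
  have h2 : HasFDerivAt (fun x : E d => (√v)⁻¹ • x)
      ((√v)⁻¹ • ContinuousLinearMap.id ℝ (E d)) x := (hasFDerivAt_id x).fun_const_smul _
  have h3 := h1.comp x h2
  convert! h3 using 1
  · ext x
    simp [heat, smul_smul, hs]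
  · simp [heatGrad, smul_smul, hs]

lemma norm_heat_le {v : ℝ} {H : E d → F} {M : ℝ} (hM : ∀ x, ‖H x‖ ≤ M) (x : E d) :
    ‖heat v H x‖ ≤ M := by
  have h := norm_integral_le_of_norm_le_const (μ := stdGaussian (E d))
    (f := fun z => H (x + √v • z)) (ae_of_all _ fun z => hM _)
  simpa [heat] using h

omit [NormedSpace ℝ F] in
lemma integrable_comp_add_smul {v : ℝ} {H : E d → F} (hH : Continuous H) {M : ℝ}
    (hM : ∀ x, ‖H x‖ ≤ M) (x : E d) :
    Integrable (fun z => H (x + √v • z)) (stdGaussian (E d)) :=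
  Integrable.of_bound (by fun_prop) M (ae_of_all _ fun z => hM _)

lemma integrable_norm_stdGaussian : Integrable (fun z : E d => ‖z‖) (stdGaussian (E d)) :=
  (IsGaussian.integrable_id (μ := stdGaussian (E d))).norm

lemma integrable_sq_norm_stdGaussian :
    Integrable (fun z : E d => ‖z‖ ^ 2) (stdGaussian (E d)) :=
  (IsGaussian.memLp_two_id (μ := stdGaussian (E d))).integrable_norm_pow (by norm_num)

lemma integrable_smulRight {v : ℝ} {H : E d → F} (hH : Continuous H) {M : ℝ}
    (hM : ∀ x, ‖H x‖ ≤ M) (x : E d) :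
    Integrable (fun z => (innerSL ℝ z).smulRight (H (x + √v • z))) (stdGaussian (E d)) := by
  refine (integrable_norm_stdGaussian.mul_const M).mono' (by fun_prop) (ae_of_all _ fun z => ?_)
  rw [ContinuousLinearMap.norm_smulRight_apply, innerSL_apply_norm]
  gcongr
  exact hM _

lemma continuous_heatGrad {v : ℝ} {H : E d → F} (hH : Continuous H) {M : ℝ}
    (hM : ∀ x, ‖H x‖ ≤ M) : Continuous (heatGrad v H) := by
  suffices Continuous fun x =>
      ∫ z, (innerSL ℝ z).smulRight (H (x + √v • z)) ∂(stdGaussian (E d)) from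
    this.const_smul (√v)⁻¹
  refine continuous_of_dominated (bound := fun z => ‖z‖ * M) (fun x => by fun_prop)
    (fun x => ae_of_all _ fun z => ?_) (integrable_norm_stdGaussian.mul_const M)
    (ae_of_all _ fun z => by fun_prop)
  rw [ContinuousLinearMap.norm_smulRight_apply, innerSL_apply_norm]
  gcongr
  exact hM _

/-- The constant `𝔼 [1 + ‖Z‖²]`, which dominates `𝔼 ‖Z‖^{1+α}` for all `α ∈ [0, 1]`. -/
noncomputable def gaussMoment (d : ℕ) : ℝ := ∫ z, (1 + ‖z‖ ^ 2) ∂(stdGaussian (E d))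

lemma gaussMoment_nonneg (d : ℕ) : 0 ≤ gaussMoment d :=
  integral_nonneg fun z => by positivity

variable [CompleteSpace F]

/-- Smoothing: the gradient of the Gaussian average of an `α`-Hölder function is at most of order
`v^{(α-1)/2}`. The case `α = 0` is that of functions with bounded oscillation. -/
lemma norm_heatGrad_le {v : ℝ} (hv : 0 < v) {H : E d → F} (hH : Continuous H) {M : ℝ}
    (hM : ∀ x, ‖H x‖ ≤ M) {α A : ℝ} (hα : 0 ≤ α) (hα1 : α ≤ 1) (hA : 0 ≤ A)
    (hHol : ∀ x y, ‖H x - H y‖ ≤ A * ‖x - y‖ ^ α) (x : E d) :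
    ‖heatGrad v H x‖ ≤ gaussMoment d * A * v ^ ((α - 1) / 2) := by
  have hs : 0 < √v := Real.sqrt_pos.2 hv
  -- A constant has zero gradient, so `H(x)` may be subtracted from the integrand.
  have h0 : heatGrad v (fun _ => H x) x = 0 :=
    (hasFDerivAt_heat hv continuous_const (fun _ => hM x) x).unique (by
      have : heat v (fun _ : E d => H x) = fun _ => H x := by ext y; simp [heat]
      rw [this]
      exact hasFDerivAt_const _ _)
  have h1 : heatGrad v H x = (√v)⁻¹ • ∫ z, (innerSL ℝ z).smulRight (H (x + √v • z) - H x)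
      ∂(stdGaussian (E d)) := by
    have h2 : heatGrad v H x = heatGrad v H x - heatGrad v (fun _ => H x) x := by
      rw [h0, sub_zero]
    rw [h2]
    unfold heatGrad
    rw [← smul_sub, ← integral_sub (integrable_smulRight hH hM x)
      (integrable_smulRight (v := v) continuous_const (fun _ => hM x) x)]
    refine congrArg ((√v)⁻¹ • ·) (integral_congr_ae (ae_of_all _ fun z => ?_))
    ext w
    simp [smul_sub]
  have h3 : ‖∫ z, (innerSL ℝ z).smulRight (H (x + √v • z) - H x) ∂(stdGaussian (E d))‖ ≤
      ∫ z, A * √v ^ α * (1 + ‖z‖ ^ 2) ∂(stdGaussian (E d)) := by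
    refine norm_integral_le_of_norm_le
      (((integrable_const 1).add integrable_sq_norm_stdGaussian).const_mul _)
      (ae_of_all _ fun z => ?_)
    rw [ContinuousLinearMap.norm_smulRight_apply, innerSL_apply_norm]
    have h4 := hHol (x + √v • z) x
    rw [add_sub_cancel_left, norm_smul, Real.norm_of_nonneg hs.le,
      Real.mul_rpow hs.le (norm_nonneg _)] at h4
    have h5 : ‖z‖ * ‖z‖ ^ α ≤ 1 + ‖z‖ ^ 2 := by
      rcases le_total ‖z‖ 1 with h | h
      · have := Real.rpow_le_one (norm_nonneg z) h hα
        nlinarith [norm_nonneg z, Real.rpow_nonneg (norm_nonneg z) α]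
      · have := Real.rpow_le_rpow_of_exponent_le h hα1
        rw [Real.rpow_one] at this
        nlinarith
    calc ‖z‖ * ‖H (x + √v • z) - H x‖ ≤ ‖z‖ * (A * (√v ^ α * ‖z‖ ^ α)) := by gcongr
      _ = A * √v ^ α * (‖z‖ * ‖z‖ ^ α) := by ring
      _ ≤ _ := by gcongr
  rw [integral_const_mul] at h3
  rw [h1, norm_smul, norm_inv, Real.norm_of_nonneg hs.le]
  have h6 : v ^ ((α - 1) / 2) = (√v)⁻¹ * √v ^ α := by
    rw [Real.sqrt_eq_rpow, ← Real.rpow_neg hv.le, ← Real.rpow_mul hv.le, ← Real.rpow_add hv]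
    congr 1; ring
  rw [h6]
  calc _ ≤ (√v)⁻¹ * (A * √v ^ α * gaussMoment d) := by
        gcongr
        exact h3
    _ = _ := by ring

end GaussianAverage

end OUScore

namespace OUScore

/-! ### The heat semigroup and its smoothing estimates -/

section HeatSemigroup

variable {d : ℕ} {F : Type} [NormedAddCommGroup F] [NormedSpace ℝ F]

lemma ae_stdGaussian_add_smul {v : ℝ} (hv : 0 < v) {p : E d → Prop}
    (h : ∀ᵐ y ∂(volume : Measure (E d)), p y) (x : E d) :
    ∀ᵐ z ∂(stdGaussian (E d)), p (x + √v • z) := by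
  have hs : √v ≠ 0 := (Real.sqrt_pos.2 hv).ne'
  have h1 : ∀ᵐ y ∂(volume : Measure (E d)), p (x + y) :=
    (measurePreserving_add_left (volume : Measure (E d)) x).quasiMeasurePreserving.ae h
  have h2 : ∀ᵐ z ∂(volume : Measure (E d)), p (x + √v • z) :=
    (Measure.quasiMeasurePreserving_smul (volume : Measure (E d)) hs).ae h1
  rw [stdGaussian_eq_withDensity]
  exact (withDensity_absolutelyContinuous _ _).ae_le h2

lemma hasFDerivAt_heat_of_lipschitzWith {v : ℝ} (hv : 0 < v) {H : E d → F} {L : ℝ≥0}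
    (hL : LipschitzWith L H) {M : ℝ} (hM : ∀ x, ‖H x‖ ≤ M)
    (hd : ∀ᵐ y ∂(volume : Measure (E d)), DifferentiableAt ℝ H y)
    (hm : StronglyMeasurable (fderiv ℝ H)) (x : E d) :
    HasFDerivAt (heat v H) (heat v (fderiv ℝ H) x) x := by
  have hc := hL.continuous
  refine (hasFDerivAt_integral_of_dominated_loc_of_lip (bound := fun _ => (L : ℝ))
    (s := Set.univ) Filter.univ_mem ?_ ?_ ?_ ?_ (integrable_const _) ?_).2
  · exact Filter.Eventually.of_forall fun x =>
      (integrable_comp_add_smul hc hM x).aestronglyMeasurable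
  · exact integrable_comp_add_smul hc hM x
  · exact (hm.comp_measurable (by fun_prop)).aestronglyMeasurable
  · refine ae_of_all _ fun z => LipschitzWith.lipschitzOnWith ?_
    refine LipschitzWith.of_dist_le_mul fun y y' => ?_
    simpa using hL.dist_le_mul (y + √v • z) (y' + √v • z)
  · filter_upwards [ae_stdGaussian_add_smul hv hd x] with z hz
    exact (hasFDerivAt_comp_add_right _).2 hz.hasFDerivAt

lemma fderiv_heat_of_contDiff {v : ℝ} (hv : 0 < v) {H : E d → F} (hH : ContDiff ℝ 1 H) {M L : ℝ}
    (hM : ∀ x, ‖H x‖ ≤ M) (hL : ∀ x, ‖fderiv ℝ H x‖ ≤ L) :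
    fderiv ℝ (heat v H) = heat v (fderiv ℝ H) := by
  have hlip : LipschitzWith L.toNNReal H :=
    lipschitzWith_of_nnnorm_fderiv_le (hH.differentiable (by norm_num)) fun x => by
      rw [← NNReal.coe_le_coe, coe_nnnorm]
      exact (hL x).trans (Real.le_coe_toNNReal L)
  ext1 x
  exact (hasFDerivAt_heat_of_lipschitzWith hv hlip hM
    (ae_of_all _ (hH.differentiable (by norm_num)))
    (hH.continuous_fderiv (by norm_num)).stronglyMeasurable x).fderiv

lemma map_stdGaussian_conv {v w : ℝ} (hv : 0 ≤ v) (hw : 0 ≤ w) :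
    ((stdGaussian (E d)).map (√v • ·)).conv ((stdGaussian (E d)).map (√w • ·)) =
      (stdGaussian (E d)).map (√(v + w) • ·) := by
  have : ∀ u : ℝ, IsProbabilityMeasure ((stdGaussian (E d)).map (√u • ·)) := fun u =>
    Measure.isProbabilityMeasure_map (by fun_prop)
  apply Measure.ext_of_charFun
  ext t
  rw [charFun_conv, charFun_map_smul, charFun_map_smul, charFun_map_smul]
  simp only [charFun_stdGaussian, norm_smul, ← Complex.exp_add]
  congr 1
  push_cast
  simp only [mul_pow, ← Complex.ofReal_pow, Real.norm_eq_abs, sq_abs, Real.sq_sqrt hv,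
    Real.sq_sqrt hw, Real.sq_sqrt (add_nonneg hv hw)]
  push_cast
  ring

lemma heat_eq_integral_map (v : ℝ) {H : E d → F} (hH : Continuous H) (x : E d) :
    heat v H x = ∫ u, H (x + u) ∂((stdGaussian (E d)).map (√v • ·)) := by
  rw [integral_map (by fun_prop) (by fun_prop)]
  rfl

lemma continuous_heat {v : ℝ} {H : E d → F} (hH : Continuous H) {M : ℝ} (hM : ∀ x, ‖H x‖ ≤ M) :
    Continuous (heat v H) :=
  continuous_of_dominated (bound := fun _ => M) (fun x => by fun_prop)
    (fun x => ae_of_all _ fun z => hM _) (integrable_const _) (ae_of_all _ fun z => by fun_prop)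

lemma heat_heat {v w : ℝ} (hv : 0 ≤ v) (hw : 0 ≤ w) {H : E d → F} (hH : Continuous H) {M : ℝ}
    (hM : ∀ x, ‖H x‖ ≤ M) : heat v (heat w H) = heat (v + w) H := by
  have : ∀ u : ℝ, IsProbabilityMeasure ((stdGaussian (E d)).map (√u • ·)) := fun u =>
    Measure.isProbabilityMeasure_map (by fun_prop)
  ext1 x
  rw [heat_eq_integral_map _ (continuous_heat hH hM), heat_eq_integral_map _ hH,
    ← map_stdGaussian_conv hv hw, integral_conv]
  · simp_rw [heat_eq_integral_map w hH, add_assoc]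
  · exact Integrable.of_bound (by fun_prop) M (ae_of_all _ fun z => hM _)

variable [CompleteSpace F]

lemma norm_heatGrad_le_of_bounded {v : ℝ} (hv : 0 < v) {H : E d → F} (hH : Continuous H) {M : ℝ}
    (hM : ∀ x, ‖H x‖ ≤ M) (x : E d) :
    ‖heatGrad v H x‖ ≤ gaussMoment d * (2 * M) * v ^ (-(1 / 2) : ℝ) := by
  have hM0 : 0 ≤ M := (norm_nonneg _).trans (hM 0)
  have h := norm_heatGrad_le hv hH hM (α := 0) (A := 2 * M) le_rfl zero_le_one (by positivity)
    (fun x y => by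
      rw [Real.rpow_zero, mul_one]
      linarith [norm_sub_le (H x) (H y), hM x, hM y]) x
  convert h using 3
  norm_num

/-- Half of the variance is spent on differentiating, and the other half is left to smooth the
derivative. -/
lemma fderiv_heat {v : ℝ} (hv : 0 < v) {H : E d → F} (hH : Continuous H) {M : ℝ}
    (hM : ∀ x, ‖H x‖ ≤ M) :
    fderiv ℝ (heat v H) = heat (v / 2) (heatGrad (v / 2) H) := by
  have hv2 : 0 < v / 2 := by positivity
  have h1 : fderiv ℝ (heat (v / 2) H) = heatGrad (v / 2) H :=
    funext fun x => (hasFDerivAt_heat hv2 hH hM x).fderiv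
  have hC1 : ContDiff ℝ 1 (heat (v / 2) H) := by
    rw [contDiff_one_iff_fderiv, h1]
    exact ⟨fun x => (hasFDerivAt_heat hv2 hH hM x).differentiableAt, continuous_heatGrad hH hM⟩
  conv_lhs => rw [← add_halves v, ← heat_heat hv2.le hv2.le hH hM]
  rw [fderiv_heat_of_contDiff hv2 hC1 (fun x => norm_heat_le hM x)
    (fun x => by rw [h1]; exact norm_heatGrad_le_of_bounded hv2 hH hM x), h1]

end HeatSemigroup

lemma contDiff_heat {d : ℕ} (n : ℕ) {F : Type} [NormedAddCommGroup F] [NormedSpace ℝ F]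
    [CompleteSpace F] {v : ℝ} (hv : 0 < v) {H : E d → F} (hH : Continuous H) {M : ℝ}
    (hM : ∀ x, ‖H x‖ ≤ M) : ContDiff ℝ n (heat v H) := by
  induction n generalizing F v M with
  | zero => exact contDiff_zero.2 (continuous_heat hH hM)
  | succ n ih =>
    have hv2 : 0 < v / 2 := by positivity
    push_cast
    rw [contDiff_succ_iff_fderiv, fderiv_heat hv hH hM]
    refine ⟨fun x => (hasFDerivAt_heat hv hH hM x).differentiableAt, by simp, ?_⟩
    exact ih hv2 (continuous_heatGrad hH hM) (norm_heatGrad_le_of_bounded hv2 hH hM)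

/-- The derivative of order `j` of the Gaussian average of a bounded function is at most of order
`v^{-j/2}`. -/
lemma exists_norm_iteratedFDeriv_heat_le (d j : ℕ) :
    ∃ C : ℝ, 0 ≤ C ∧ ∀ (F : Type) [NormedAddCommGroup F] [NormedSpace ℝ F] [CompleteSpace F]
      (v : ℝ), 0 < v → ∀ (H : E d → F) (M : ℝ), Continuous H → (∀ x, ‖H x‖ ≤ M) → ∀ x,
        ‖iteratedFDeriv ℝ j (heat v H) x‖ ≤ C * M * v ^ (-(j : ℝ) / 2) := by
  induction j with
  | zero =>
    refine ⟨1, zero_le_one, fun F _ _ _ v hv H M hH hM x => ?_⟩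
    rw [norm_iteratedFDeriv_zero]
    simpa using norm_heat_le hM x
  | succ j ih =>
    obtain ⟨C, hC0, hC⟩ := ih
    refine ⟨C * (gaussMoment d * 2) * (1 / 2 : ℝ) ^ (-((j : ℝ) + 1) / 2), ?_, ?_⟩
    · have := gaussMoment_nonneg d
      positivity
    intro F _ _ _ v hv H M hH hM x
    have hv2 : 0 < v / 2 := by positivity
    rw [← norm_iteratedFDeriv_fderiv, fderiv_heat hv hH hM]
    refine (hC _ _ hv2 _ _ (continuous_heatGrad hH hM)
      (norm_heatGrad_le_of_bounded hv2 hH hM) x).trans (le_of_eq ?_)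
    have h1 : (v / 2) ^ (-(1 / 2) : ℝ) * (v / 2) ^ (-(j : ℝ) / 2) =
        (1 / 2 : ℝ) ^ (-((j : ℝ) + 1) / 2) * v ^ (-((j : ℝ) + 1) / 2) := by
      rw [← Real.rpow_add hv2, ← Real.mul_rpow (by norm_num) hv.le]
      congr 1 <;> ring
    push_cast
    calc _ = C * (gaussMoment d * 2) * M *
            ((v / 2) ^ (-(1 / 2) : ℝ) * (v / 2) ^ (-(j : ℝ) / 2)) := by ring
      _ = _ := by rw [h1]; ring

/-- The derivative of order `j + 1` of the Gaussian average of a bounded `α`-Hölder function is at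
most of order `v^{(α-j-1)/2}`. -/
lemma exists_norm_iteratedFDeriv_heat_le_of_holder (d j : ℕ) {α : ℝ} (hα : 0 ≤ α) (hα1 : α ≤ 1) :
    ∃ C : ℝ, 0 ≤ C ∧ ∀ (F : Type) [NormedAddCommGroup F] [NormedSpace ℝ F] [CompleteSpace F]
      (v : ℝ), 0 < v → ∀ (H : E d → F) (M A : ℝ), Continuous H → (∀ x, ‖H x‖ ≤ M) → 0 ≤ A →
        (∀ x y, ‖H x - H y‖ ≤ A * ‖x - y‖ ^ α) → ∀ x,
        ‖iteratedFDeriv ℝ (j + 1) (heat v H) x‖ ≤ C * A * v ^ ((α - (j + 1)) / 2) := by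
  obtain ⟨C, hC0, hC⟩ := exists_norm_iteratedFDeriv_heat_le d j
  refine ⟨C * gaussMoment d * (1 / 2 : ℝ) ^ ((α - (j + 1)) / 2), ?_, ?_⟩
  · have := gaussMoment_nonneg d
    positivity
  intro F _ _ _ v hv H M A hH hM hA hHol x
  have hv2 : 0 < v / 2 := by positivity
  rw [← norm_iteratedFDeriv_fderiv, fderiv_heat hv hH hM]
  refine (hC _ _ hv2 _ _ (continuous_heatGrad hH hM)
    (norm_heatGrad_le hv2 hH hM hα hα1 hA hHol) x).trans (le_of_eq ?_)
  have h1 : (v / 2) ^ ((α - 1) / 2) * (v / 2) ^ (-(j : ℝ) / 2) =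
      (1 / 2 : ℝ) ^ ((α - (j + 1)) / 2) * v ^ ((α - (j + 1)) / 2) := by
    rw [← Real.rpow_add hv2, ← Real.mul_rpow (by norm_num) hv.le]
    congr 1 <;> ring
  calc _ = C * gaussMoment d * A * ((v / 2) ^ ((α - 1) / 2) * (v / 2) ^ (-(j : ℝ) / 2)) := by
        ring
    _ = _ := by rw [h1]; ring

/-- `H` lies in the ball of radius `B` of the Hölder space `C^{n,α}`, in terms of the operator
norms of the differentials. The exponent `α = 1` is allowed: then the differential of order `n` is
Lipschitz. -/
structure HolderBounded {d : ℕ} {F : Type} [NormedAddCommGroup F] [NormedSpace ℝ F] (n : ℕ)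
    (α B : ℝ) (H : E d → F) : Prop where
  contDiff : ContDiff ℝ n H
  norm_le : ∀ k ≤ n, ∀ x, ‖iteratedFDeriv ℝ k H x‖ ≤ B
  norm_sub_le : ∀ x y, ‖iteratedFDeriv ℝ n H x - iteratedFDeriv ℝ n H y‖ ≤ B * ‖x - y‖ ^ α

namespace HolderBounded

variable {d n : ℕ} {F : Type} [NormedAddCommGroup F] [NormedSpace ℝ F] {α B : ℝ} {H : E d → F}

lemma nonneg (h : HolderBounded n α B H) : 0 ≤ B :=
  (norm_nonneg _).trans (h.norm_le 0 (Nat.zero_le _) 0)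

lemma norm_apply_le (h : HolderBounded n α B H) (x : E d) : ‖H x‖ ≤ B := by
  simpa using h.norm_le 0 (Nat.zero_le _) x

lemma fderiv (h : HolderBounded (n + 1) α B H) : HolderBounded n α B (fderiv ℝ H) where
  contDiff := h.contDiff.fderiv_right (by norm_cast)
  norm_le k hk x := by
    rw [norm_iteratedFDeriv_fderiv]
    exact h.norm_le _ (by lia) x
  norm_sub_le x y := by
    have := h.norm_sub_le x y
    rw [iteratedFDeriv_succ_eq_comp_right, iteratedFDeriv_succ_eq_comp_right] at this
    have e := (continuousMultilinearCurryRightEquiv' ℝ n (E d) F).symm.dist_map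
      (iteratedFDeriv ℝ n (_root_.fderiv ℝ H) x) (iteratedFDeriv ℝ n (_root_.fderiv ℝ H) y)
    rw [dist_eq_norm, dist_eq_norm] at e
    exact e ▸ this

lemma fderiv_heat (h : HolderBounded (n + 1) α B H) {v : ℝ} (hv : 0 < v) :
    _root_.fderiv ℝ (heat v H) = heat v (_root_.fderiv ℝ H) :=
  fderiv_heat_of_contDiff hv (h.contDiff.of_le (by norm_cast; lia)) h.norm_apply_le
    h.fderiv.norm_apply_le

lemma norm_iteratedFDeriv_heat_le (h : HolderBounded n α B H) {v : ℝ} (hv : 0 < v) {k : ℕ}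
    (hk : k ≤ n) (x : E d) : ‖iteratedFDeriv ℝ k (heat v H) x‖ ≤ B := by
  induction k generalizing F n with
  | zero => simpa using norm_heat_le h.norm_apply_le x
  | succ k ih =>
    obtain ⟨n, rfl⟩ : ∃ n', n = n' + 1 := ⟨n - 1, by lia⟩
    rw [← norm_iteratedFDeriv_fderiv, h.fderiv_heat hv]
    exact ih h.fderiv (by lia)

end HolderBounded

/-- Heat smoothing of a `C^{n,α}` function: each derivative beyond the order `n + α` costs a
factor `v^{-1/2}`. -/
lemma exists_norm_iteratedFDeriv_heat_le_of_holderBounded (d j : ℕ) {α : ℝ} (hα : 0 ≤ α)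
    (hα1 : α ≤ 1) :
    ∃ C : ℝ, 0 ≤ C ∧ ∀ (n : ℕ) (F : Type) [NormedAddCommGroup F] [NormedSpace ℝ F]
      [CompleteSpace F] (B : ℝ) (H : E d → F), HolderBounded n α B H → ∀ v : ℝ, 0 < v → ∀ x,
        ‖iteratedFDeriv ℝ (n + (j + 1)) (heat v H) x‖ ≤ C * B * v ^ ((α - (j + 1)) / 2) := by
  obtain ⟨C, hC0, hC⟩ := exists_norm_iteratedFDeriv_heat_le_of_holder d j hα hα1
  refine ⟨C, hC0, fun n => ?_⟩
  induction n with
  | zero =>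
    intro F _ _ _ B H h v hv x
    rw [zero_add]
    refine hC F v hv H B B h.contDiff.continuous h.norm_apply_le h.nonneg (fun x y => ?_) x
    have := h.norm_sub_le x y
    rwa [iteratedFDeriv_zero_eq_comp, Function.comp_apply, Function.comp_apply, ← map_sub,
      LinearIsometryEquiv.norm_map] at this
  | succ n ih =>
    intro F _ _ _ B H h v hv x
    rw [show n + 1 + (j + 1) = n + (j + 1) + 1 by ring, ← norm_iteratedFDeriv_fderiv,
      h.fderiv_heat hv]
    exact ih _ B _ h.fderiv v hv x

end OUScore

namespace OUScore

/-! ### Weighted bounds for the derivatives of exponentials and logarithms -/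

/-- A weight on orders of differentiation that is compatible with the Leibniz rule. -/
structure IsDerivWeight (w : ℕ → ℝ) : Prop where
  nonneg : ∀ k, 0 ≤ w k
  zero : w 0 = 1
  mul_le : ∀ i j, w i * w j ≤ w (i + j)

section Weights

variable {d : ℕ} {F : Type} [NormedAddCommGroup F] [NormedSpace ℝ F]

lemma norm_iteratedFDeriv_smul_le_of_weight {w : ℕ → ℝ} (hw : IsDerivWeight w) {N : ℕ}
    {f : E d → ℝ} {G : E d → F} (hf : ContDiff ℝ N f) (hG : ContDiff ℝ N G) {A B : ℝ}
    (hA : 0 ≤ A) (hB : 0 ≤ B) {x : E d} (hfA : ∀ i ≤ N, ‖iteratedFDeriv ℝ i f x‖ ≤ A * w i)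
    (hGB : ∀ i ≤ N, ‖iteratedFDeriv ℝ i G x‖ ≤ B * w (i + 1)) :
    ‖iteratedFDeriv ℝ N (fun y => f y • G y) x‖ ≤ 2 ^ N * A * B * w (N + 1) := by
  refine (norm_iteratedFDeriv_smul_le hf hG x le_rfl).trans ?_
  calc _ ≤ ∑ i ∈ Finset.range (N + 1), (N.choose i : ℝ) * (A * B * w (N + 1)) := by
        refine Finset.sum_le_sum fun i hi => ?_
        have hi' : i ≤ N := Finset.mem_range_succ_iff.1 hi
        have h1 := hw.mul_le i (N - i + 1)
        rw [show i + (N - i + 1) = N + 1 by lia] at h1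
        rw [mul_assoc]
        refine mul_le_mul_of_nonneg_left ?_ (Nat.cast_nonneg _)
        calc _ ≤ (A * w i) * (B * w (N - i + 1)) :=
              mul_le_mul (hfA i hi') (hGB _ (Nat.sub_le _ _)) (norm_nonneg _)
                (mul_nonneg hA (hw.nonneg _))
          _ = A * B * (w i * w (N - i + 1)) := by ring
          _ ≤ _ := mul_le_mul_of_nonneg_left h1 (mul_nonneg hA hB)
    _ = _ := by
        rw [← Finset.sum_mul, ← Nat.cast_sum, Nat.sum_range_choose]
        push_cast
        ring

/-- Weighted derivative bounds pass from `f` to `exp f`, since `∇ exp f = exp f • ∇ f`. -/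
lemma exists_norm_iteratedFDeriv_exp_le (d N : ℕ) {A B : ℝ} (hA : 0 ≤ A) (hB : 0 ≤ B) :
    ∃ C : ℝ, 0 ≤ C ∧ ∀ w : ℕ → ℝ, IsDerivWeight w → ∀ f : E d → ℝ, ContDiff ℝ N f →
      (∀ x, Real.exp (f x) ≤ A) →
      (∀ k, 1 ≤ k → k ≤ N → ∀ x, ‖iteratedFDeriv ℝ k f x‖ ≤ B * w k) →
      ∀ k ≤ N, ∀ x, ‖iteratedFDeriv ℝ k (fun y => Real.exp (f y)) x‖ ≤ C * w k := by
  induction N with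
  | zero =>
    refine ⟨A, hA, fun w hw f _ hfA _ k hk x => ?_⟩
    obtain rfl : k = 0 := by lia
    rw [norm_iteratedFDeriv_zero, hw.zero, mul_one, Real.norm_of_nonneg (Real.exp_pos _).le]
    exact hfA x
  | succ N ih =>
    obtain ⟨C, hC0, hC⟩ := ih
    refine ⟨max C (2 ^ N * C * B), le_max_of_le_left hC0, fun w hw f hf hfA hfB k hk x => ?_⟩
    have hfN : ContDiff ℝ N f := hf.of_le (by norm_cast; lia)
    have hlow := hC w hw f hfN hfA fun k h1 h2 => hfB k h1 (by lia)
    rcases Nat.lt_or_ge N k with h | h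
    · obtain rfl : k = N + 1 := by lia
      have hd : fderiv ℝ (fun y => Real.exp (f y)) = fun y => Real.exp (f y) • fderiv ℝ f y :=
        funext fun y => fderiv_exp ((hf.differentiable (by simp)).differentiableAt)
      rw [← norm_iteratedFDeriv_fderiv, hd]
      refine (norm_iteratedFDeriv_smul_le_of_weight hw hfN.exp (hf.fderiv_right (by norm_cast))
        hC0 hB (fun i hi => hlow i hi x) fun i hi => ?_).trans
        (mul_le_mul_of_nonneg_right (le_max_right _ _) (hw.nonneg _))
      rw [norm_iteratedFDeriv_fderiv]
      exact hfB _ (by lia) (by lia) x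
    · exact (hlow k h x).trans (mul_le_mul_of_nonneg_right (le_max_left _ _) (hw.nonneg _))

/-- Weighted derivative bounds pass from `exp f` to `f`, since `∇ f = exp (-f) • ∇ exp f`. -/
lemma exists_norm_iteratedFDeriv_le_of_exp (d N : ℕ) {A B : ℝ} (hA : 0 ≤ A) (hB : 0 ≤ B) :
    ∃ C : ℝ, 0 ≤ C ∧ ∀ w : ℕ → ℝ, IsDerivWeight w → ∀ f : E d → ℝ, ContDiff ℝ N f →
      (∀ x, Real.exp (-f x) ≤ A) →
      (∀ k ≤ N, ∀ x, ‖iteratedFDeriv ℝ k (fun y => Real.exp (f y)) x‖ ≤ B * w k) →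
      ∀ k, 1 ≤ k → k ≤ N → ∀ x, ‖iteratedFDeriv ℝ k f x‖ ≤ C * w k := by
  induction N with
  | zero => exact ⟨0, le_rfl, fun w hw f _ hfA _ k h1 h2 x => by lia⟩
  | succ N ih =>
    obtain ⟨C, hC0, hC⟩ := ih
    obtain ⟨C', hC'0, hC'⟩ := exists_norm_iteratedFDeriv_exp_le d N hA hC0
    refine ⟨max C (2 ^ N * C' * B), le_max_of_le_left hC0, fun w hw f hf hfA hfB k h1 hk x => ?_⟩
    have hfN : ContDiff ℝ N f := hf.of_le (by norm_cast; lia)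
    have hlow := hC w hw f hfN hfA fun k h2 => hfB k (by lia)
    rcases Nat.lt_or_ge N k with h | h
    · obtain rfl : k = N + 1 := by lia
      have hd : fderiv ℝ f = fun y => Real.exp (-f y) • fderiv ℝ (fun y => Real.exp (f y)) y := by
        funext y
        rw [fderiv_exp ((hf.differentiable (by simp)).differentiableAt), smul_smul,
          ← Real.exp_add, neg_add_cancel, Real.exp_zero, one_smul]
      rw [← norm_iteratedFDeriv_fderiv, hd]
      refine (norm_iteratedFDeriv_smul_le_of_weight hw hfN.neg.exp
        (hf.exp.fderiv_right (by norm_cast)) hC'0 hB (fun i hi => ?_) fun i hi => ?_).trans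
        (mul_le_mul_of_nonneg_right (le_max_right _ _) (hw.nonneg _))
      · refine hC' w hw (fun y => -f y) hfN.neg hfA (fun k h1 h2 x => ?_) i hi x
        have e : iteratedFDeriv ℝ k (fun y => -f y) x = -iteratedFDeriv ℝ k f x :=
          iteratedFDeriv_neg_apply
        rw [e, norm_neg]
        exact hlow k h1 h2 x
      · rw [norm_iteratedFDeriv_fderiv]
        exact hfB _ (by lia) x
    · exact (hlow k h1 h x).trans (mul_le_mul_of_nonneg_right (le_max_left _ _) (hw.nonneg _))

end Weights

lemma isDerivWeight_one : IsDerivWeight fun _ => 1 :=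
  ⟨fun _ => zero_le_one, rfl, fun _ _ => by norm_num⟩

/-- The weight of a small perturbation: all derivatives of positive order have size `η`. -/
lemma isDerivWeight_small {η : ℝ} (h0 : 0 ≤ η) (h1 : η ≤ 1) :
    IsDerivWeight fun k => if k = 0 then 1 else η := by
  refine ⟨fun k => by positivity, rfl, fun i j => ?_⟩
  rcases Nat.eq_zero_or_pos i with rfl | hi
  · simp
  rcases Nat.eq_zero_or_pos j with rfl | hj
  · simp
  simp only [hi.ne', hj.ne', if_false, show i + j ≠ 0 by lia]
  nlinarith

section HolderExp

variable {d n : ℕ} {α : ℝ}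

/-- The increments of the lower derivatives of a Hölder function are controlled by the mean value
inequality. -/
lemma HolderBounded.norm_iteratedFDeriv_sub_le {F : Type} [NormedAddCommGroup F] [NormedSpace ℝ F]
    {B : ℝ} {H : E d → F} (h : HolderBounded n α B H) (hα1 : α ≤ 1) {k : ℕ} (hk : k ≤ n)
    {x y : E d} (hxy : ‖x - y‖ ≤ 1) (hne : x ≠ y) :
    ‖iteratedFDeriv ℝ k H x - iteratedFDeriv ℝ k H y‖ ≤ B * ‖x - y‖ ^ α := by
  rcases hk.eq_or_lt with rfl | hlt
  · exact h.norm_sub_le x y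
  · have h1 : ‖iteratedFDeriv ℝ k H x - iteratedFDeriv ℝ k H y‖ ≤ B * ‖x - y‖ := by
      refine Convex.norm_image_sub_le_of_norm_fderiv_le (𝕜 := ℝ) (s := Set.univ)
        (fun z _ => ?_) (fun z _ => ?_) convex_univ (Set.mem_univ _) (Set.mem_univ _)
      · exact (h.contDiff.differentiable_iteratedFDeriv (by exact_mod_cast hlt)) z
      · rw [norm_fderiv_iteratedFDeriv]
        exact h.norm_le _ hlt z
    refine h1.trans (mul_le_mul_of_nonneg_left ?_ h.nonneg)
    have hpos : 0 < ‖x - y‖ := norm_pos_iff.2 (sub_ne_zero.2 hne)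
    simpa using Real.rpow_le_rpow_of_exponent_ge hpos hxy hα1

/-- Hölder bounds pass from `a` to `exp a`. For the top derivative, `exp a (· + h) - exp a` is
written as `exp a • (exp δ - 1)`, with an increment `δ` of `a` whose derivatives are all of order
`‖h‖^α`. -/
lemma exists_holderBounded_exp (d n : ℕ) {α : ℝ} (hα : 0 ≤ α) (hα1 : α ≤ 1) {B : ℝ} (hB : 0 ≤ B) :
    ∃ C : ℝ, 0 ≤ C ∧ ∀ a : E d → ℝ, HolderBounded n α B a →
      HolderBounded n α C fun x => Real.exp (a x) := by
  obtain ⟨C₁, hC₁0, hC₁⟩ := exists_norm_iteratedFDeriv_exp_le d n (Real.exp_pos B).le hB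
  obtain ⟨C₂, hC₂0, hC₂⟩ := exists_norm_iteratedFDeriv_exp_le d n (Real.exp_pos (2 * B)).le hB
  set C₃ := max C₂ (Real.exp B * B) with hC₃
  have hC₃0 : 0 ≤ C₃ := le_max_of_le_left hC₂0
  refine ⟨max (2 * C₁) (2 ^ n * C₁ * C₃), by positivity, fun a ha => ?_⟩
  have hab : ∀ x, |a x| ≤ B := ha.norm_apply_le
  have hbd : ∀ k ≤ n, ∀ x, ‖iteratedFDeriv ℝ k (fun y => Real.exp (a y)) x‖ ≤ C₁ := by
    intro k hk x
    have := hC₁ _ isDerivWeight_one a ha.contDiff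
      (fun x => Real.exp_le_exp.2 ((le_abs_self _).trans (hab x)))
      (fun k _ hk x => by simpa using ha.norm_le k hk x) k hk x
    simpa using this
  refine ⟨ha.contDiff.exp, fun k hk x => ?_, fun x y => ?_⟩
  · exact (hbd k hk x).trans (le_max_of_le_left (by linarith))
  rcases eq_or_ne x y with rfl | hne
  · simp only [sub_self, norm_zero]; positivity
  -- At distance at least one the bound is trivial; below, `η = ‖h‖^α ≤ 1` makes a weight.
  rcases le_total 1 ‖x - y‖ with hbig | hsmall
  · calc _ ≤ 2 * C₁ := by
          linarith [_root_.norm_sub_le (iteratedFDeriv ℝ n (fun y => Real.exp (a y)) x)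
            (iteratedFDeriv ℝ n (fun y => Real.exp (a y)) y), hbd n le_rfl x, hbd n le_rfl y]
      _ ≤ 2 * C₁ * ‖x - y‖ ^ α :=
          le_mul_of_one_le_right (by positivity) (Real.one_le_rpow hbig hα)
      _ ≤ _ := by gcongr; exact le_max_left _ _
  · set h := x - y with hh
    have hh0 : h ≠ 0 := sub_ne_zero.2 hne
    set η := ‖h‖ ^ α with hη
    have hη0 : 0 ≤ η := by positivity
    have hη1 : η ≤ 1 := Real.rpow_le_one (norm_nonneg _) hsmall hα
    have hsh : ContDiff ℝ n fun z => a (z + h) := ha.contDiff.comp (by fun_prop)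
    set δ : E d → ℝ := fun z => a (z + h) - a z with hδ
    have hδc : ContDiff ℝ n δ := hsh.sub ha.contDiff
    have hδk : ∀ k ≤ n, ∀ z, ‖iteratedFDeriv ℝ k δ z‖ ≤ B * η := by
      intro k hk z
      have hk' : (k : WithTop ℕ∞) ≤ n := by exact_mod_cast hk
      have e : iteratedFDeriv ℝ k δ z = iteratedFDeriv ℝ k a (z + h) - iteratedFDeriv ℝ k a z := by
        rw [← iteratedFDeriv_comp_add_right]
        exact iteratedFDeriv_sub_apply (hsh.of_le hk').contDiffAt (ha.contDiff.of_le hk').contDiffAt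
      rw [e]
      have := ha.norm_iteratedFDeriv_sub_le hα1 hk (x := z + h) (y := z) (by simpa using hsmall)
        (by simpa using hh0)
      simpa using this
    have hδ0 : ∀ z, |δ z| ≤ B * η := fun z => by simpa using hδk 0 (Nat.zero_le _) z
    set w : ℕ → ℝ := fun k => if k = 0 then 1 else η with hw
    have hexpδ := hC₂ w (isDerivWeight_small hη0 hη1) δ hδc
      (fun z => Real.exp_le_exp.2 (by
        have h1 := (abs_le.1 (hab (z + h))).2
        have h2 := (abs_le.1 (hab z)).1
        simp only [hδ]
        linarith))
      (fun k h1 hk z => by simpa [hw, show k ≠ 0 by lia] using hδk k hk z)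
    have hlow : ∀ k ≤ n, ∀ z, ‖iteratedFDeriv ℝ k (fun z => Real.exp (δ z) - 1) z‖ ≤ C₃ * η := by
      intro k hk z
      rcases Nat.eq_zero_or_pos k with rfl | hpos
      · rw [norm_iteratedFDeriv_zero, Real.norm_eq_abs]
        have hle : |δ z| ≤ B := (hδ0 z).trans (mul_le_of_le_one_right hB hη1)
        have h1 : |Real.exp (δ z) - 1| ≤ Real.exp B * |δ z| := by
          have h2 := Real.add_one_le_exp (δ z)
          have h3 := Real.add_one_le_exp (-δ z)
          have h4 : Real.exp (-δ z) * Real.exp (δ z) = 1 := by rw [← Real.exp_add]; simp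
          have h5 : Real.exp (δ z) ≤ Real.exp B := Real.exp_le_exp.2 ((le_abs_self _).trans hle)
          have h6 : 1 ≤ Real.exp B := Real.one_le_exp hB
          have h7 := Real.exp_pos (δ z)
          rw [abs_le]
          constructor
          · nlinarith [neg_abs_le (δ z), abs_nonneg (δ z)]
          · have h8 : Real.exp (δ z) - 1 ≤ Real.exp (δ z) * δ z := by nlinarith
            exact h8.trans ((mul_le_mul_of_nonneg_left (le_abs_self _) h7.le).trans
              (mul_le_mul_of_nonneg_right h5 (abs_nonneg _)))
        calc _ ≤ Real.exp B * (B * η) := h1.trans (by gcongr; exact hδ0 z)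
          _ = Real.exp B * B * η := by ring
          _ ≤ _ := by gcongr; exact le_max_right _ _
      · have e : iteratedFDeriv ℝ k (fun z => Real.exp (δ z) - 1) z =
            iteratedFDeriv ℝ k (fun z => Real.exp (δ z)) z := by
          have := iteratedFDeriv_sub_apply (𝕜 := ℝ) (i := k) (x := z)
            (f := fun z => Real.exp (δ z)) (g := fun _ => (1 : ℝ))
            ((hδc.exp.of_le (by exact_mod_cast hk)).contDiffAt) contDiff_const.contDiffAt
          rw [iteratedFDeriv_const_of_ne hpos.ne', Pi.zero_apply, sub_zero] at this
          exact this
        rw [e]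
        have := hexpδ k hk z
        simp only [hw, hpos.ne', if_false] at this
        exact this.trans (by gcongr; exact le_max_left _ _)
    have e : iteratedFDeriv ℝ n (fun y => Real.exp (a y)) x -
        iteratedFDeriv ℝ n (fun y => Real.exp (a y)) y =
        iteratedFDeriv ℝ n (fun z => Real.exp (a z) • (Real.exp (δ z) - 1)) y := by
      have e1 : (fun z => Real.exp (a z) • (Real.exp (δ z) - 1)) =
          (fun z => Real.exp (a (z + h))) - fun z => Real.exp (a z) := by
        ext z
        simp only [smul_eq_mul, mul_sub, mul_one, Pi.sub_apply, ← Real.exp_add, hδ]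
        congr 2; ring
      rw [e1, iteratedFDeriv_sub_apply hsh.exp.contDiffAt ha.contDiff.exp.contDiffAt,
        iteratedFDeriv_comp_add_right (f := fun z => Real.exp (a z)), hh, add_sub_cancel]
    rw [e]
    refine (norm_iteratedFDeriv_smul_le ha.contDiff.exp (hδc.exp.sub contDiff_const) y
      le_rfl).trans ?_
    calc _ ≤ ∑ i ∈ Finset.range (n + 1), (n.choose i : ℝ) * (C₁ * (C₃ * η)) := by
          refine Finset.sum_le_sum fun i hi => ?_
          rw [mul_assoc]
          gcongr
          · exact hbd i (Finset.mem_range_succ_iff.1 hi) y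
          · exact hlow _ (Nat.sub_le _ _) y
      _ = 2 ^ n * C₁ * C₃ * η := by
          rw [← Finset.sum_mul, ← Nat.cast_sum, Nat.sum_range_choose]
          push_cast
          ring
      _ ≤ _ := by gcongr; exact le_max_right _ _

end HolderExp

end OUScore

namespace OUScore

/-! ### The score as the gradient of the logarithm of a Gaussian average -/

section Score

variable {d : ℕ}

lemma gaussDensity_eq_smul_one {v : ℝ} (hv : 0 < v) (z : E d) :
    gaussDensity d v z = (√v ^ d)⁻¹ * gaussDensity d 1 ((√v)⁻¹ • z) := by
  have hsv : 0 < √v := Real.sqrt_pos.2 hv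
  unfold gaussDensity
  rw [norm_smul, Real.sqrt_mul (by positivity) v, mul_pow, mul_pow]
  simp only [mul_one, norm_inv, Real.norm_eq_abs, abs_of_pos hsv, inv_pow, Real.sq_sqrt hv.le]
  rw [mul_inv, ← mul_assoc, mul_comm (√v ^ d)⁻¹]
  congr 2
  field_simp

lemma heat_eq_integral_gaussDensity {v : ℝ} (hv : 0 < v) (H : E d → ℝ) (x : E d) :
    heat v H x = ∫ y, gaussDensity d v (y - x) * H y := by
  have hsv : 0 < √v := Real.sqrt_pos.2 hv
  have h1 := Measure.integral_comp_smul_of_nonneg (volume : Measure (E d))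
    (fun w => gaussDensity d 1 ((√v)⁻¹ • w) * H (x + w)) √v (hR := hsv.le)
  have h2 : ∫ y, gaussDensity d v (y - x) * H y = ∫ w, gaussDensity d v w * H (x + w) := by
    rw [← integral_add_left_eq_self (μ := (volume : Measure (E d)))
      (fun y => gaussDensity d v (y - x) * H y) x]
    simp
  rw [h2, heat, integral_stdGaussian_eq]
  simp only [smul_smul, inv_mul_cancel₀ hsv.ne', one_smul, smul_eq_mul, finrank_euclideanSpace,
    Fintype.card_fin] at h1 ⊢
  rw [h1, ← integral_const_mul]
  congr 1 with w
  rw [gaussDensity_eq_smul_one hv]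
  ring

/-- Completing the square: the Gaussian factor of the target splits off from the density of the
Ornstein-Uhlenbeck process. -/
lemma ouDensity_eq (a : E d → ℝ) {t : ℝ} (ht : 0 < t) (x : E d) :
    ouDensity a t x = Real.exp (-‖x‖ ^ 2 / 2) *
      heat (1 - Real.exp (-2 * t)) (fun y => Real.exp (a y)) (Real.exp (-t) • x) := by
  have hc2 : Real.exp (-2 * t) = Real.exp (-t) ^ 2 := by
    rw [← Real.exp_nat_mul]; congr 1; push_cast; ring
  have hv : 0 < 1 - Real.exp (-2 * t) := by
    have : Real.exp (-2 * t) < 1 := Real.exp_lt_one_iff.2 (by linarith)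
    linarith
  rw [heat_eq_integral_gaussDensity hv, ouDensity, ← integral_const_mul]
  congr 1 with y
  rw [hc2] at hv ⊢
  set c := Real.exp (-t)
  unfold target gaussDensity
  rw [Real.exp_add]
  have key : Real.exp (-‖y‖ ^ 2 / 2) * Real.exp (-‖x - c • y‖ ^ 2 / (2 * (1 - c ^ 2))) =
      Real.exp (-‖x‖ ^ 2 / 2) * Real.exp (-‖y - c • x‖ ^ 2 / (2 * (1 - c ^ 2))) := by
    rw [← Real.exp_add, ← Real.exp_add]
    congr 1
    rw [norm_sub_sq_real, norm_sub_sq_real, inner_smul_right, inner_smul_right, norm_smul,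
      norm_smul, real_inner_comm x y, mul_pow, mul_pow, Real.norm_eq_abs, sq_abs]
    field_simp
    ring
  linear_combination (√(2 * Real.pi * (1 - c ^ 2)) ^ d)⁻¹ * Real.exp (a y) * key

/-- The smoothed perturbation `log P_v e^a` of the Gaussian potential. -/
noncomputable def logHeat (a : E d → ℝ) (v : ℝ) (x : E d) : ℝ :=
  Real.log (heat v (fun y => Real.exp (a y)) x)

/-- The weight `v^{-(k-β)⁺/2}`: derivatives up to order `β` are bounded, and each further order
costs a factor `v^{-1/2}`. -/
noncomputable def heatWeight (β v : ℝ) (k : ℕ) : ℝ := v ^ (-(max 0 (k - β)) / 2)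

lemma isDerivWeight_heatWeight {β v : ℝ} (hβ : 0 ≤ β) (hv : 0 < v) (hv1 : v ≤ 1) :
    IsDerivWeight (heatWeight β v) := by
  refine ⟨fun k => Real.rpow_nonneg hv.le _, ?_, fun i j => ?_⟩
  · simp [heatWeight, hβ]
  · unfold heatWeight
    rw [← Real.rpow_add hv]
    refine Real.rpow_le_rpow_of_exponent_ge hv hv1 ?_
    have hi : (0 : ℝ) ≤ i := Nat.cast_nonneg i
    have hj : (0 : ℝ) ≤ j := Nat.cast_nonneg j
    have : max 0 ((i : ℝ) - β) + max 0 ((j : ℝ) - β) ≤ max 0 (((i + j : ℕ) : ℝ) - β) := by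
      push_cast
      rcases le_total (i : ℝ) β with h1 | h1 <;> rcases le_total (j : ℝ) β with h2 | h2
      · rw [max_eq_left (by linarith), max_eq_left (by linarith)]
        simp
      · rw [max_eq_left (by linarith), max_eq_right (by linarith)]
        exact le_max_of_le_right (by linarith)
      · rw [max_eq_right (by linarith), max_eq_left (by linarith)]
        exact le_max_of_le_right (by linarith)
      · rw [max_eq_right (by linarith), max_eq_right (by linarith)]
        exact le_max_of_le_right (by linarith)
    linarith

lemma exists_norm_iteratedFDeriv_heat_le_heatWeight (d n N : ℕ) {α : ℝ} (hα : 0 ≤ α) (hα1 : α ≤ 1)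
    (B : ℝ) :
    ∃ C : ℝ, 0 ≤ C ∧ ∀ H : E d → ℝ, HolderBounded n α B H → ∀ v : ℝ, 0 < v →
      ∀ k ≤ N, ∀ x, ‖iteratedFDeriv ℝ k (heat v H) x‖ ≤ C * heatWeight (n + α) v k := by
  choose C hC0 hC using fun j =>
    exists_norm_iteratedFDeriv_heat_le_of_holderBounded d j hα hα1
  have hS : 0 ≤ ∑ j ∈ Finset.range (N + 1), C j := Finset.sum_nonneg fun j _ => hC0 j
  refine ⟨|B| + (∑ j ∈ Finset.range (N + 1), C j) * |B|, by positivity, fun H h v hv k hk x => ?_⟩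
  rw [abs_of_nonneg h.nonneg]
  have hB := h.nonneg
  rcases le_or_gt k n with hkn | hkn
  · have hw : heatWeight (n + α) v k = 1 := by
      have : (k : ℝ) ≤ n := by exact_mod_cast hkn
      rw [heatWeight, max_eq_left (by linarith)]
      simp
    rw [hw, mul_one]
    exact (h.norm_iteratedFDeriv_heat_le hv hkn x).trans (le_add_of_nonneg_right (by positivity))
  · obtain ⟨j, rfl⟩ : ∃ j, k = n + (j + 1) := ⟨k - n - 1, by lia⟩
    have hw : heatWeight (n + α) v (n + (j + 1)) = v ^ ((α - (j + 1)) / 2) := by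
      have : (0 : ℝ) ≤ j := Nat.cast_nonneg j
      rw [heatWeight, max_eq_right (by push_cast; linarith)]
      congr 1
      push_cast
      ring
    rw [hw]
    refine (hC j n ℝ B H h v hv x).trans ?_
    gcongr
    have := Finset.single_le_sum (f := C) (fun j _ => hC0 j) (Finset.mem_range.2
      (show j < N + 1 by lia))
    nlinarith

lemma exp_neg_le_heat_exp {a : E d → ℝ} {B v : ℝ} (hc : Continuous a) (ha : ∀ x, |a x| ≤ B)
    (x : E d) : Real.exp (-B) ≤ heat v (fun y => Real.exp (a y)) x := by
  have h1 : ∫ _z, Real.exp (-B) ∂(stdGaussian (E d)) ≤ heat v (fun y => Real.exp (a y)) x := by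
    refine integral_mono (integrable_const _) (integrable_comp_add_smul (M := Real.exp B)
      (hc.rexp) (fun x => ?_) x) fun z => Real.exp_le_exp.2 (abs_le.1 (ha _)).1
    rw [Real.norm_of_nonneg (Real.exp_pos _).le]
    exact Real.exp_le_exp.2 (abs_le.1 (ha _)).2
  simpa using h1

lemma contDiff_logHeat {a : E d → ℝ} {B v : ℝ} (hv : 0 < v) (hc : Continuous a)
    (ha : ∀ x, |a x| ≤ B) (N : ℕ) : ContDiff ℝ N (logHeat a v) := by
  refine ContDiff.log (contDiff_heat N hv hc.rexp (M := Real.exp B) fun x => ?_) fun x => ?_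
  · rw [Real.norm_of_nonneg (Real.exp_pos _).le]
    exact Real.exp_le_exp.2 (abs_le.1 (ha _)).2
  · exact ((Real.exp_pos _).trans_le (exp_neg_le_heat_exp hc ha x)).ne'

lemma exists_norm_iteratedFDeriv_logHeat_le (d n N : ℕ) {α : ℝ} (hα : 0 ≤ α) (hα1 : α ≤ 1) {B : ℝ}
    (hB : 0 ≤ B) :
    ∃ C : ℝ, 0 ≤ C ∧ ∀ a : E d → ℝ, HolderBounded n α B a → ∀ v : ℝ, 0 < v → v ≤ 1 →
      ∀ k, 1 ≤ k → k ≤ N → ∀ x,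
        ‖iteratedFDeriv ℝ k (logHeat a v) x‖ ≤ C * heatWeight (n + α) v k := by
  obtain ⟨C₁, hC₁0, hC₁⟩ := exists_holderBounded_exp d n hα hα1 hB
  obtain ⟨C₂, hC₂0, hC₂⟩ := exists_norm_iteratedFDeriv_heat_le_heatWeight d n N hα hα1 C₁
  obtain ⟨C, hC0, hC⟩ := exists_norm_iteratedFDeriv_le_of_exp d N (Real.exp_pos B).le hC₂0
  refine ⟨C, hC0, fun a ha v hv hv1 => ?_⟩
  have hc := ha.contDiff.continuous
  have hpos : ∀ x, 0 < heat v (fun y => Real.exp (a y)) x := fun x =>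
    (Real.exp_pos _).trans_le (exp_neg_le_heat_exp hc ha.norm_apply_le x)
  have he : (fun y => Real.exp (logHeat a v y)) = heat v fun y => Real.exp (a y) :=
    funext fun y => Real.exp_log (hpos y)
  refine hC _ (isDerivWeight_heatWeight (by positivity) hv hv1) _
    (contDiff_logHeat hv hc ha.norm_apply_le N) (fun x => ?_) ?_
  · rw [Real.exp_neg, congrFun he x, inv_le_comm₀ (hpos x) (Real.exp_pos _), ← Real.exp_neg]
    exact exp_neg_le_heat_exp hc ha.norm_apply_le x
  · rw [he]
    exact hC₂ _ (hC₁ a ha) v hv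

lemma score_add_self_eq {a : E d → ℝ} {B t : ℝ} (ht : 0 < t) (hc : Continuous a)
    (ha : ∀ x, |a x| ≤ B) (x : E d) :
    score a t x + x =
      Real.exp (-t) • ∇ (logHeat a (1 - Real.exp (-2 * t))) (Real.exp (-t) • x) := by
  have hv : 0 < 1 - Real.exp (-2 * t) := by
    have : Real.exp (-2 * t) < 1 := Real.exp_lt_one_iff.2 (by linarith)
    linarith
  set v := 1 - Real.exp (-2 * t) with hvdef
  set c := Real.exp (-t)
  have hlog : (fun y => Real.log (ouDensity a t y)) =
      fun y => -(1 / 2) * ‖y‖ ^ 2 + logHeat a v (c • y) := by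
    funext y
    rw [ouDensity_eq a ht, Real.log_mul (Real.exp_pos _).ne'
      ((Real.exp_pos _).trans_le (exp_neg_le_heat_exp hc ha _)).ne', Real.log_exp, logHeat]
    ring
  have hL : HasFDerivAt (logHeat a v) (fderiv ℝ (logHeat a v) (c • x)) (c • x) :=
    ((contDiff_logHeat hv hc ha 1).differentiable (by norm_num) _).hasFDerivAt
  have h2 : HasFDerivAt (fun y : E d => c • y) (c • ContinuousLinearMap.id ℝ (E d)) x :=
    (hasFDerivAt_id x).fun_const_smul _
  have h3 := ((hasStrictFDerivAt_norm_sq x).hasFDerivAt.const_mul (-(1 / 2) : ℝ)).add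
    (hL.comp x h2)
  have h4 : HasGradientAt (fun y => Real.log (ouDensity a t y))
      (-x + c • ∇ (logHeat a v) (c • x)) x := by
    rw [hasGradientAt_iff_hasFDerivAt, hlog]
    convert! h3 using 1
    ext y
    simp
  rw [score, h4.gradient]
  abel

lemma contDiff_gradient_logHeat {a : E d → ℝ} {B v : ℝ} (hv : 0 < v) (hc : Continuous a)
    (ha : ∀ x, |a x| ≤ B) (N : ℕ) : ContDiff ℝ N (∇ (logHeat a v)) :=
  (InnerProductSpace.toDual ℝ (E d)).symm.contDiff.comp
    ((contDiff_logHeat hv hc ha (N + 1)).fderiv_right (by norm_cast))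

lemma norm_iteratedFDeriv_gradient (f : E d → ℝ) (k : ℕ) (x : E d) :
    ‖iteratedFDeriv ℝ k (∇ f) x‖ = ‖iteratedFDeriv ℝ (k + 1) f x‖ := by
  rw [← norm_iteratedFDeriv_fderiv]
  exact (InnerProductSpace.toDual ℝ (E d)).symm.norm_iteratedFDeriv_comp_left (fderiv ℝ f) x k

lemma exists_norm_iteratedFDeriv_score_le (d n N : ℕ) {α : ℝ} (hα : 0 ≤ α) (hα1 : α ≤ 1) {B : ℝ}
    (hB : 0 ≤ B) :
    ∃ C : ℝ, 0 ≤ C ∧ ∀ a : E d → ℝ, HolderBounded n α B a → ∀ t : ℝ, 0 < t →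
      (∀ k : ℕ, ContDiff ℝ k (score a t)) ∧
      ∀ k ≤ N, ∀ x, ‖iteratedFDeriv ℝ k (fun y => score a t y + y) x‖ ≤
        C * Real.exp (-t) * heatWeight (n + α) (1 - Real.exp (-2 * t)) (k + 1) := by
  obtain ⟨C, hC0, hC⟩ := exists_norm_iteratedFDeriv_logHeat_le d n (N + 1) hα hα1 hB
  refine ⟨C, hC0, fun a ha t ht => ?_⟩
  have hv : 0 < 1 - Real.exp (-2 * t) := by
    have : Real.exp (-2 * t) < 1 := Real.exp_lt_one_iff.2 (by linarith)
    linarith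
  have hv1 : 1 - Real.exp (-2 * t) ≤ 1 := by linarith [Real.exp_pos (-2 * t)]
  have hbd := hC a ha _ hv hv1
  have hfun : (fun y => score a t y + y) = fun y =>
      Real.exp (-t) • ∇ (logHeat a (1 - Real.exp (-2 * t))) (Real.exp (-t) • y) :=
    funext fun y => score_add_self_eq ht ha.contDiff.continuous ha.norm_apply_le y
  have hG := contDiff_gradient_logHeat hv ha.contDiff.continuous ha.norm_apply_le
  set v := 1 - Real.exp (-2 * t) with hvdef
  set c := Real.exp (-t) with hcdef
  have hc0 : 0 < c := Real.exp_pos _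
  have hc1 : c ≤ 1 := Real.exp_le_one_iff.2 (by linarith)
  have hcomp : ∀ k : ℕ, ContDiff ℝ k fun y : E d => ∇ (logHeat a v) (c • y) := fun k =>
    (hG k).comp (by fun_prop)
  refine ⟨fun k => ?_, fun k hk x => ?_⟩
  · have h1 : ContDiff ℝ k fun y => score a t y + y := by
      rw [hfun]; exact (hcomp k).const_smul c
    simpa using h1.sub contDiff_id
  · rw [hfun, iteratedFDeriv_const_smul_apply' (hcomp k).contDiffAt,
      iteratedFDeriv_comp_const_smul c (hG k), norm_smul, norm_smul, norm_pow,
      Real.norm_of_nonneg hc0.le, norm_iteratedFDeriv_gradient]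
    have h1 : c ^ k ≤ 1 := pow_le_one₀ hc0.le hc1
    have h2 := hbd (k + 1) (by lia) (by lia) (c • x)
    calc _ ≤ c * (1 * (C * heatWeight (n + α) v (k + 1))) := by gcongr
      _ = _ := by ring

end Score

end OUScore

namespace OUScore

/-! ### Coordinate derivatives and operator norms -/

section CoordinateDerivatives

variable {d : ℕ}

/-- The iterated partial derivative of `f` in the coordinate directions of the list `l`, which
need not be sorted; `pderiv ν` is the case of the sorted list `dirs ν`. -/
noncomputable def listDeriv (l : List (Fin d)) (f : E d → ℝ) (x : E d) : ℝ :=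
  iteratedFDeriv ℝ l.length f x fun j => EuclideanSpace.single (l.get j) (1 : ℝ)

lemma pderiv_eq_listDeriv (ν : Fin d → ℕ) (f : E d → ℝ) : pderiv ν f = listDeriv (dirs ν) f := rfl

lemma hasFDerivAt_listDeriv {l : List (Fin d)} {f : E d → ℝ} {x : E d}
    (h : DifferentiableAt ℝ (iteratedFDeriv ℝ l.length f) x) :
    HasFDerivAt (listDeriv l f)
      ((ContinuousMultilinearMap.apply ℝ (fun _ : Fin l.length => E d) ℝ
        fun j => EuclideanSpace.single (l.get j) (1 : ℝ)).comp
          (fderiv ℝ (iteratedFDeriv ℝ l.length f) x)) x :=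
  (ContinuousMultilinearMap.apply ℝ (fun _ : Fin l.length => E d) ℝ
    fun j => EuclideanSpace.single (l.get j) (1 : ℝ)).hasFDerivAt.comp x h.hasFDerivAt

lemma listDeriv_cons {l : List (Fin d)} {f : E d → ℝ} {x : E d}
    (h : DifferentiableAt ℝ (iteratedFDeriv ℝ l.length f) x) (i : Fin d) :
    listDeriv (i :: l) f x = fderiv ℝ (listDeriv l f) x (EuclideanSpace.single i 1) := by
  rw [(hasFDerivAt_listDeriv h).fderiv]
  rfl

lemma contDiff_listDeriv {l : List (Fin d)} {f : E d → ℝ} {r n : ℕ} (hf : ContDiff ℝ n f)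
    (h : l.length + r ≤ n) : ContDiff ℝ r (listDeriv l f) := by
  have h1 : ContDiff ℝ r (iteratedFDeriv ℝ l.length f) :=
    hf.iteratedFDeriv_right (by rw [add_comm]; exact_mod_cast h)
  exact (ContinuousMultilinearMap.apply ℝ (fun _ : Fin l.length => E d) ℝ
    fun j => EuclideanSpace.single (l.get j) (1 : ℝ)).contDiff.comp h1

lemma listDeriv_cons_of_contDiff {l : List (Fin d)} {f : E d → ℝ} {n : ℕ} (hf : ContDiff ℝ n f)
    (h : l.length < n) (i : Fin d) :
    listDeriv (i :: l) f = fun x => fderiv ℝ (listDeriv l f) x (EuclideanSpace.single i 1) :=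
  funext fun x => listDeriv_cons ((hf.differentiable_iteratedFDeriv (by exact_mod_cast h)) x) i

/-- Partial derivatives of a smooth function commute. -/
lemma listDeriv_perm {l l' : List (Fin d)} (hl : l.Perm l') {f : E d → ℝ} {n : ℕ}
    (hf : ContDiff ℝ n f) (h : l.length ≤ n) : listDeriv l f = listDeriv l' f := by
  induction hl with
  | nil => rfl
  | cons i hp ih =>
    rw [List.length_cons] at h
    rw [listDeriv_cons_of_contDiff hf h,
      listDeriv_cons_of_contDiff hf (by rw [← hp.length_eq]; lia), ih (by lia)]
  | swap i j l =>
    simp only [List.length_cons] at h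
    have h2 : ContDiff ℝ 2 (listDeriv l f) := contDiff_listDeriv (r := 2) hf (by lia)
    have h3 : Differentiable ℝ (fderiv ℝ (listDeriv l f)) :=
      (h2.fderiv_right (m := 1) (by norm_num)).differentiable (by norm_num)
    have e : ∀ i j, listDeriv (i :: j :: l) f = fun x =>
        fderiv ℝ (fun y => fderiv ℝ (listDeriv l f) y (EuclideanSpace.single j 1)) x
          (EuclideanSpace.single i 1) := fun i j => by
      rw [listDeriv_cons_of_contDiff hf (by rw [List.length_cons]; lia),
        listDeriv_cons_of_contDiff hf (by lia)]
    rw [e, e]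
    funext x
    rw [fderiv_clm_apply (h3 x) (differentiableAt_const _),
      fderiv_clm_apply (h3 x) (differentiableAt_const _)]
    simpa using (h2.contDiffAt.isSymmSndFDerivAt (by simp)) (EuclideanSpace.single j 1)
      (EuclideanSpace.single i 1)
  | trans h1 _ ih1 ih2 => rw [ih1 h, ih2 (by rw [← h1.length_eq]; exact h)]

lemma count_dirs (ν : Fin d → ℕ) (i : Fin d) : (dirs ν).count i = ν i := by
  have : (List.count i ∘ fun j => List.replicate (ν j) j) = fun j => if j = i then ν j else 0 := by
    ext j
    simp [List.count_replicate]
  rw [dirs, List.count_flatMap, this, ← List.ofFn_eq_map, List.sum_ofFn]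
  simp

lemma length_dirs (ν : Fin d → ℕ) : (dirs ν).length = ∑ i, ν i := by
  rw [dirs, List.length_flatMap, ← List.ofFn_eq_map, List.sum_ofFn]
  simp

lemma exists_perm_dirs (l : List (Fin d)) :
    ∃ ν ∈ Finset.piAntidiag (Finset.univ : Finset (Fin d)) l.length, l.Perm (dirs ν) := by
  have hp : l.Perm (dirs fun i => l.count i) := List.perm_iff_count.2 fun i => by rw [count_dirs]
  refine ⟨fun i => l.count i, ?_, hp⟩
  rw [Finset.mem_piAntidiag, ← length_dirs, hp.length_eq]
  simp

lemma norm_listDeriv_le (l : List (Fin d)) (f : E d → ℝ) (x : E d) :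
    |listDeriv l f x| ≤ ‖iteratedFDeriv ℝ l.length f x‖ := by
  have := (iteratedFDeriv ℝ l.length f x).le_opNorm
    fun j => EuclideanSpace.single (l.get j) (1 : ℝ)
  simpa [listDeriv] using this

lemma listDeriv_sub_le (l : List (Fin d)) (f : E d → ℝ) (x y : E d) :
    |listDeriv l f x - listDeriv l f y| ≤
      ‖iteratedFDeriv ℝ l.length f x - iteratedFDeriv ℝ l.length f y‖ := by
  have := (iteratedFDeriv ℝ l.length f x - iteratedFDeriv ℝ l.length f y).le_opNorm
    fun j => EuclideanSpace.single (l.get j) (1 : ℝ)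
  simpa [listDeriv] using this

lemma norm_le_of_apply_single_le {n : ℕ} (T : (E d) [×n]→L[ℝ] ℝ) {K : ℝ} (hK : 0 ≤ K)
    (h : ∀ r : Fin n → Fin d, |T fun j => EuclideanSpace.single (r j) (1 : ℝ)| ≤ K) :
    ‖T‖ ≤ d ^ n * K := by
  refine T.opNorm_le_bound (by positivity) fun u => ?_
  have hu : u = fun j => ∑ i, (u j i) • EuclideanSpace.single i (1 : ℝ) := by
    funext j
    ext i
    simp [Pi.single_apply]
  calc ‖T u‖ = ‖∑ r : Fin n → Fin d, (∏ j, u j (r j)) •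
          T fun j => EuclideanSpace.single (r j) (1 : ℝ)‖ := by
        conv_lhs => rw [hu, T.map_sum]
        simp_rw [T.map_smul_univ]
    _ ≤ ∑ r : Fin n → Fin d, (∏ j, ‖u j‖) * K := by
        refine (norm_sum_le _ _).trans (Finset.sum_le_sum fun r _ => ?_)
        rw [norm_smul, norm_prod]
        gcongr with j
        · exact PiLp.norm_apply_le (u j) (r j)
        · exact h r
    _ = d ^ n * K * ∏ j, ‖u j‖ := by
        simp
        ring

lemma iteratedFDeriv_apply_single {n : ℕ} (r : Fin n → Fin d) (f : E d → ℝ) (x : E d) :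
    iteratedFDeriv ℝ n f x (fun j => EuclideanSpace.single (r j) (1 : ℝ)) =
      listDeriv (List.ofFn r) f x := by
  have key : ∀ (l : List (Fin d)) (hl : l.length = n), iteratedFDeriv ℝ n f x
      (fun j => EuclideanSpace.single (l.get (Fin.cast hl.symm j)) (1 : ℝ)) = listDeriv l f x := by
    rintro l rfl
    rfl
  rw [← key _ (List.length_ofFn)]
  simp

/-- By symmetry, the partial derivatives `∂^ν` with sorted directions control the full
differential. -/
lemma norm_iteratedFDeriv_le_of_pderiv {n : ℕ} {f : E d → ℝ} (hf : ContDiff ℝ n f) {K : ℝ}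
    (hK : 0 ≤ K) {x : E d}
    (h : ∀ ν ∈ Finset.piAntidiag (Finset.univ : Finset (Fin d)) n, |pderiv ν f x| ≤ K) :
    ‖iteratedFDeriv ℝ n f x‖ ≤ d ^ n * K := by
  refine norm_le_of_apply_single_le _ hK fun r => ?_
  obtain ⟨ν, hν, hp⟩ := exists_perm_dirs (List.ofFn r)
  rw [List.length_ofFn] at hν
  rw [iteratedFDeriv_apply_single, listDeriv_perm hp hf (by simp)]
  exact h ν hν

lemma norm_iteratedFDeriv_sub_le_of_pderiv {n : ℕ} {f : E d → ℝ} (hf : ContDiff ℝ n f) {K : ℝ}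
    (hK : 0 ≤ K) {x y : E d}
    (h : ∀ ν ∈ Finset.piAntidiag (Finset.univ : Finset (Fin d)) n,
      |pderiv ν f x - pderiv ν f y| ≤ K) :
    ‖iteratedFDeriv ℝ n f x - iteratedFDeriv ℝ n f y‖ ≤ d ^ n * K := by
  refine norm_le_of_apply_single_le _ hK fun r => ?_
  obtain ⟨ν, hν, hp⟩ := exists_perm_dirs (List.ofFn r)
  rw [List.length_ofFn] at hν
  rw [sub_apply, iteratedFDeriv_apply_single, iteratedFDeriv_apply_single,
    listDeriv_perm hp hf (by simp)]
  exact h ν hν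

instance finiteDimensional_continuousMultilinearMap (n : ℕ) :
    FiniteDimensional ℝ ((E d) [×n]→L[ℝ] ℝ) :=
  Module.Finite.of_injective
    (ContinuousMultilinearMap.toMultilinearMapLinear (R' := ℝ) (A := ℝ) :
      ((E d) [×n]→L[ℝ] ℝ) →ₗ[ℝ] MultilinearMap ℝ (fun _ : Fin n => E d) ℝ)
    ContinuousMultilinearMap.toMultilinearMap_injective

end CoordinateDerivatives

end OUScore

namespace OUScore

/-! ### The Hölder ball in terms of operator norms -/

section HolderBall

variable {d : ℕ}

/-- Differentiation commutes with the heat semigroup on Lipschitz functions, whose derivative exists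
almost everywhere by Rademacher's theorem. -/
lemma fderiv_heat_apply_of_lipschitzWith {v : ℝ} (hv : 0 < v) {g : E d → ℝ} {L : ℝ≥0}
    (hL : LipschitzWith L g) {M : ℝ} (hM : ∀ x, |g x| ≤ M) (x e : E d) :
    fderiv ℝ (heat v g) x e = heat v (fun y => fderiv ℝ g y e) x := by
  have hm : StronglyMeasurable (fderiv ℝ g) := (measurable_fderiv ℝ g).stronglyMeasurable
  rw [(hasFDerivAt_heat_of_lipschitzWith hv hL hM hL.ae_differentiableAt hm x).fderiv]
  refine ContinuousLinearMap.integral_apply (Integrable.of_bound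
    (hm.comp_measurable (by fun_prop)).aestronglyMeasurable (L : ℝ)
    (ae_of_all _ fun z => norm_fderiv_le_of_lipschitz ℝ hL)) e

lemma abs_heat_sub_le {v : ℝ} {g : E d → ℝ} {L : ℝ≥0} (hL : LipschitzWith L g) {M : ℝ}
    (hM : ∀ x, |g x| ≤ M) (x : E d) :
    |heat v g x - g x| ≤ L * √v * ∫ z, ‖z‖ ∂(stdGaussian (E d)) := by
  have h1 : heat v g x - g x = ∫ z, (g (x + √v • z) - g x) ∂(stdGaussian (E d)) := by
    rw [integral_sub (integrable_comp_add_smul hL.continuous hM x) (integrable_const _)]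
    simp [heat]
  rw [h1, ← integral_const_mul, ← Real.norm_eq_abs]
  refine norm_integral_le_of_norm_le (integrable_norm_stdGaussian.const_mul _)
    (ae_of_all _ fun z => ?_)
  have h2 := hL.dist_le_mul (x + √v • z) x
  rw [dist_eq_norm, dist_eq_norm, add_sub_cancel_left, norm_smul,
    Real.norm_of_nonneg (Real.sqrt_nonneg _)] at h2
  rwa [mul_assoc]

lemma lipschitzWith_listDeriv {l : List (Fin d)} {f : E d → ℝ} {L : ℝ≥0}
    (hL : LipschitzWith L (iteratedFDeriv ℝ l.length f)) : LipschitzWith L (listDeriv l f) :=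
  LipschitzWith.of_dist_le_mul fun x y => by
    have := hL.dist_le_mul x y
    rw [dist_eq_norm] at this
    exact (listDeriv_sub_le l f x y).trans this

lemma lipschitzWith_iteratedFDeriv {n k : ℕ} {f : E d → ℝ} {B : ℝ} (hf : ContDiff ℝ n f)
    (hk : k < n) (hB : ∀ x, ‖iteratedFDeriv ℝ (k + 1) f x‖ ≤ B) :
    LipschitzWith B.toNNReal (iteratedFDeriv ℝ k f) :=
  lipschitzWith_of_nnnorm_fderiv_le (𝕜 := ℝ)
    (hf.differentiable_iteratedFDeriv (by exact_mod_cast hk)) fun x => by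
      rw [← NNReal.coe_le_coe, coe_nnnorm, norm_fderiv_iteratedFDeriv]
      exact (hB x).trans (Real.le_coe_toNNReal B)

/-- The heat semigroup commutes with all derivatives up to the order of differentiability of the
function; at each step the derivative at hand is Lipschitz. -/
lemma listDeriv_heat {v : ℝ} (hv : 0 < v) {n : ℕ} {f : E d → ℝ} {B : ℝ} (hf : ContDiff ℝ n f)
    (hB : ∀ k ≤ n, ∀ x, ‖iteratedFDeriv ℝ k f x‖ ≤ B) (l : List (Fin d)) (hl : l.length ≤ n) :
    listDeriv l (heat v f) = heat v (listDeriv l f) := by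
  have hf0 : ∀ x, ‖f x‖ ≤ B := fun x => by simpa using hB 0 (Nat.zero_le _) x
  induction l with
  | nil =>
    have e : ∀ f : E d → ℝ, listDeriv [] f = f := fun f => rfl
    rw [e, e]
  | cons i l ih =>
    rw [List.length_cons] at hl
    rw [listDeriv_cons_of_contDiff (contDiff_heat n hv hf.continuous hf0) (by lia),
      listDeriv_cons_of_contDiff hf (by lia), ih (by lia)]
    funext x
    exact fderiv_heat_apply_of_lipschitzWith hv
      (lipschitzWith_listDeriv (lipschitzWith_iteratedFDeriv hf hl (hB _ hl)))
      (fun x => (norm_listDeriv_le l f x).trans (hB _ (by lia) x)) x _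

/-- An almost everywhere bound on the partial derivatives of order `n + 1` is a Lipschitz bound on
the differential of order `n`. It is proved for the smooth function `heat v f`, whose partial
derivatives commute, and `v` then tends to zero. -/
lemma norm_iteratedFDeriv_sub_le_of_ae {n : ℕ} {f : E d → ℝ} {B K : ℝ} (hK : 0 ≤ K)
    (hf : ContDiff ℝ n f) (hB : ∀ k ≤ n, ∀ x, ‖iteratedFDeriv ℝ k f x‖ ≤ B) {L : ℝ≥0}
    (hL : LipschitzWith L (iteratedFDeriv ℝ n f))
    (h : ∀ ν ∈ Finset.piAntidiag (Finset.univ : Finset (Fin d)) (n + 1),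
      ∀ᵐ x ∂(volume : Measure (E d)), |pderiv ν f x| ≤ K) (x y : E d) :
    ‖iteratedFDeriv ℝ n f x - iteratedFDeriv ℝ n f y‖ ≤ d ^ n * (d ^ (n + 1) * K * ‖x - y‖) := by
  have hf0 : ∀ x, ‖f x‖ ≤ B := fun x => by simpa using hB 0 (Nat.zero_le _) x
  have hdiff : ∀ᵐ x ∂(volume : Measure (E d)), DifferentiableAt ℝ (iteratedFDeriv ℝ n f) x :=
    hL.ae_differentiableAt
  have hsmooth : ∀ v : ℝ, 0 < v → ∀ x, ‖iteratedFDeriv ℝ (n + 1) (heat v f) x‖ ≤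
      d ^ (n + 1) * K := by
    intro v hv x
    refine norm_iteratedFDeriv_le_of_pderiv (contDiff_heat (n + 1) hv hf.continuous hf0) hK
      fun ν hν => ?_
    have hae := h ν hν
    have hlen : (dirs ν).length = n + 1 := by
      rw [length_dirs]; exact (Finset.mem_piAntidiag.1 hν).1
    rw [pderiv_eq_listDeriv] at hae ⊢
    obtain ⟨i, l, hil⟩ : ∃ i l, dirs ν = i :: l :=
      List.exists_cons_of_length_pos (by lia)
    rw [hil] at hae hlen ⊢
    obtain rfl : l.length = n := by simpa using hlen
    rw [listDeriv_cons_of_contDiff (contDiff_heat (l.length + 1) hv hf.continuous hf0)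
      (Nat.lt_succ_self _), listDeriv_heat hv hf hB l le_rfl]
    beta_reduce
    rw [fderiv_heat_apply_of_lipschitzWith hv (lipschitzWith_listDeriv hL)
      (fun x => (norm_listDeriv_le l f x).trans (hB _ le_rfl x)) x]
    have hae' : ∀ᵐ y ∂(volume : Measure (E d)),
        ‖fderiv ℝ (listDeriv l f) y (EuclideanSpace.single i 1)‖ ≤ K := by
      filter_upwards [hae, hdiff] with y h1 h2
      rwa [listDeriv_cons h2] at h1
    have := norm_integral_le_of_norm_le_const (μ := stdGaussian (E d))
      (ae_stdGaussian_add_smul hv hae' x)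
    simpa [heat] using this
  refine norm_iteratedFDeriv_sub_le_of_pderiv hf (by positivity) fun ν hν => ?_
  have hlen : (dirs ν).length = n := by
    rw [length_dirs]; exact (Finset.mem_piAntidiag.1 hν).1
  rw [pderiv_eq_listDeriv]
  subst hlen
  set g := listDeriv (dirs ν) f with hg
  have hgL : LipschitzWith L g := lipschitzWith_listDeriv hL
  have hgB : ∀ x, |g x| ≤ B := fun x => (norm_listDeriv_le _ f x).trans (hB _ le_rfl x)
  set m := ∫ z, ‖z‖ ∂(stdGaussian (E d)) with hm
  have happrox : ∀ v : ℝ, 0 < v →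
      |g x - g y| ≤ d ^ ((dirs ν).length + 1) * K * ‖x - y‖ + 2 * (L * √v * m) := by
    intro v hv
    have h1 : |heat v g x - heat v g y| ≤ d ^ ((dirs ν).length + 1) * K * ‖x - y‖ := by
      rw [hg, ← listDeriv_heat hv hf hB _ le_rfl]
      refine (listDeriv_sub_le _ _ x y).trans ?_
      have := (lipschitzWith_iteratedFDeriv (contDiff_heat _ hv hf.continuous hf0)
        (Nat.lt_succ_self _) (hsmooth v hv)).dist_le_mul x y
      rwa [dist_eq_norm, dist_eq_norm, Real.coe_toNNReal _ (by positivity)] at this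
    have h2 := abs_heat_sub_le (v := v) hgL hgB x
    have h3 := abs_heat_sub_le (v := v) hgL hgB y
    rw [abs_le] at h1 h2 h3 ⊢
    constructor <;> linarith
  have hlim : Filter.Tendsto
      (fun v : ℝ => d ^ ((dirs ν).length + 1) * K * ‖x - y‖ + 2 * (L * √v * m))
      (nhdsWithin 0 (Set.Ioi 0)) (nhds (d ^ ((dirs ν).length + 1) * K * ‖x - y‖)) := by
    have hc : Continuous fun v : ℝ =>
      d ^ ((dirs ν).length + 1) * K * ‖x - y‖ + 2 * (L * √v * m) := by fun_prop
    have := (hc.tendsto 0).mono_left (nhdsWithin_le_nhds (s := Set.Ioi (0 : ℝ)))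
    simpa using this
  exact ge_of_tendsto hlim (Filter.mem_of_superset self_mem_nhdsWithin happrox)

lemma abs_le_of_ae_of_continuous {p : E d → ℝ} (hp : Continuous p) {K : ℝ}
    (h : ∀ᵐ x ∂(volume : Measure (E d)), |p x| ≤ K) (x : E d) : |p x| ≤ K := by
  have hd := Measure.dense_of_ae h
  have hcl : IsClosed {x | |p x| ≤ K} := isClosed_le hp.abs continuous_const
  have := hcl.closure_eq ▸ hd x
  exact this

lemma ae_abs_pderiv_le_of_holderNorm_le {η K : ℝ} (hK : 0 ≤ K) {f : E d → ℝ}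
    (h : holderNorm η f ≤ ENNReal.ofReal K) {k : ℕ} (hk : k ≤ ⌊η⌋₊) {ν : Fin d → ℕ}
    (hν : ν ∈ Finset.piAntidiag (Finset.univ : Finset (Fin d)) k) :
    ∀ᵐ x ∂(volume : Measure (E d)), |pderiv ν f x| ≤ K := by
  have h1 : eLpNorm (pderiv ν f) ∞ volume ≤ ENNReal.ofReal K := by
    refine le_trans ?_ h
    refine le_trans ?_ le_self_add
    refine le_trans (Finset.single_le_sum (f := fun ν : Fin d → ℕ => eLpNorm (pderiv ν f) ∞ volume)
      (fun _ _ => zero_le) hν) ?_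
    exact Finset.single_le_sum (f := fun k =>
      ∑ ν ∈ Finset.piAntidiag (Finset.univ : Finset (Fin d)) k, eLpNorm (pderiv ν f) ∞ volume)
      (fun _ _ => zero_le) (Finset.mem_range.2 (Nat.lt_succ_of_le hk))
  rw [eLpNorm_exponent_top] at h1
  filter_upwards [ae_le_eLpNormEssSup (f := pderiv ν f) (μ := volume)] with x hx
  have := hx.trans h1
  rwa [← ofReal_norm, ENNReal.ofReal_le_ofReal_iff hK] at this

lemma abs_pderiv_sub_le_of_holderNorm_le {η K : ℝ} (hK : 0 ≤ K) {f : E d → ℝ}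
    (hf : ContDiff ℝ ⌊η⌋₊ f) (h : holderNorm η f ≤ ENNReal.ofReal K) {ν : Fin d → ℕ}
    (hν : ν ∈ Finset.piAntidiag (Finset.univ : Finset (Fin d)) ⌊η⌋₊) {x y : E d} (hxy : x ≠ y) :
    |pderiv ν f x - pderiv ν f y| ≤ K * ‖x - y‖ ^ (η - ⌊η⌋₊) := by
  have hmem : ∀ z, z ∈ diffPoints ⌊η⌋₊ f := fun z k hk =>
    (hf.differentiable_iteratedFDeriv (by exact_mod_cast hk)) z
  have h1 : holderSeminorm η ν f ≤ ENNReal.ofReal K :=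
    (Finset.single_le_sum (f := fun ν => holderSeminorm η ν f) (fun _ _ => zero_le) hν).trans
      (le_add_self.trans h)
  have h2 : ‖pderiv ν f x - pderiv ν f y‖ₑ / ENNReal.ofReal (‖x - y‖ ^ (η - ⌊η⌋₊)) ≤
      ENNReal.ofReal K := by
    refine le_trans ?_ h1
    refine le_iSup₂_of_le x (hmem x) ?_
    refine le_iSup₂_of_le y (hmem y) ?_
    exact le_iSup_of_le hxy le_rfl
  have hpos : 0 < ‖x - y‖ ^ (η - ⌊η⌋₊) :=
    Real.rpow_pos_of_pos (norm_pos_iff.2 (sub_ne_zero.2 hxy)) _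
  rw [ENNReal.div_le_iff (by simpa using hpos) ENNReal.ofReal_ne_top, ← ENNReal.ofReal_mul hK,
    ← ofReal_norm, ENNReal.ofReal_le_ofReal_iff (by positivity)] at h2
  exact h2

/-- The Hölder ball of order `β` consists of functions with `C^{n,α}` bounds, where `β = n + α` with
`α ∈ (0, 1]`; so for an integer `β` the pair is `(β - 1, 1)`. -/
lemma exists_holderBounded_of_mem_holderBall (hd : 0 < d) {β K : ℝ} (hβ : 1 ≤ β) (hK : 0 ≤ K) :
    ∃ (n : ℕ) (α B : ℝ), 0 ≤ α ∧ α ≤ 1 ∧ 0 ≤ B ∧ n + α = β ∧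
      ∀ a ∈ holderBall d β K, HolderBounded n α B a := by
  set m := ⌊β⌋₊ with hm
  have hd1 : (1 : ℝ) ≤ d := by exact_mod_cast hd
  have hm1 : 1 ≤ m := Nat.le_floor (by exact_mod_cast hβ)
  have hmβ : (m : ℝ) ≤ β := Nat.floor_le (by linarith)
  have hβm : β < m + 1 := Nat.lt_floor_add_one β
  have hlow : ∀ (n : ℕ), n ≤ m → ∀ a ∈ holderBall d β K, ContDiff ℝ n a → ∀ k ≤ n, ∀ x,
      ‖iteratedFDeriv ℝ k a x‖ ≤ d ^ m * K := by
    intro n hn a ha hc k hk x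
    have hck : ContDiff ℝ k a := hc.of_le (by exact_mod_cast hk)
    calc ‖iteratedFDeriv ℝ k a x‖ ≤ d ^ k * K := by
          refine norm_iteratedFDeriv_le_of_pderiv hck hK fun ν hν => ?_
          have hlen : (dirs ν).length = k := by
            rw [length_dirs]; exact (Finset.mem_piAntidiag.1 hν).1
          refine abs_le_of_ae_of_continuous ?_
            (ae_abs_pderiv_le_of_holderNorm_le hK ha.2 (hk.trans hn) hν) x
          rw [pderiv_eq_listDeriv]
          exact (contDiff_listDeriv (r := 0) hck (by lia)).continuous
      _ ≤ _ := by gcongr; exact hk.trans hn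
  by_cases hint : β = m
  · obtain ⟨n, hn⟩ : ∃ n, m = n + 1 := ⟨m - 1, by lia⟩
    refine ⟨n, 1, d ^ n * (d ^ m * K), zero_le_one, le_rfl, by positivity, ?_, fun a ha => ?_⟩
    · rw [hint, hn]; push_cast; ring
    have hreg := ha.1.2 hint
    rw [← hm, hn, Nat.add_sub_cancel] at hreg
    obtain ⟨hc, L, hL⟩ := hreg
    have hB := hlow n (by lia) a ha hc
    refine ⟨hc, fun k hk x => (hB k hk x).trans (le_mul_of_one_le_left (by positivity)
      (one_le_pow₀ hd1)), fun x y => ?_⟩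
    rw [Real.rpow_one]
    refine (norm_iteratedFDeriv_sub_le_of_ae hK hc hB hL (fun ν hν =>
      ae_abs_pderiv_le_of_holderNorm_le hK ha.2 (hm ▸ hn.ge) hν) x y).trans (le_of_eq ?_)
    rw [hn]
    ring
  · refine ⟨m, β - m, d ^ m * K, by linarith, by linarith, by positivity, by ring, fun a ha => ?_⟩
    have hc : ContDiff ℝ m a := ha.1.1 hint
    refine ⟨hc, hlow m le_rfl a ha hc, fun x y => ?_⟩
    rcases eq_or_ne x y with rfl | hne
    · simp only [sub_self, norm_zero]
      positivity
    · rw [mul_assoc]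
      exact norm_iteratedFDeriv_sub_le_of_pderiv hc (by positivity) fun ν hν =>
        abs_pderiv_sub_le_of_holderNorm_le hK hc ha.2 hν hne

end HolderBall

/-! ### Rates in time and conclusion -/

/-- The variance `v = 1 - e^{-2t}` satisfies `1 / v ≤ 1 + 1 / t`, at all times `t`. -/
lemma rpow_neg_one_sub_exp_le {t p : ℝ} (ht : 0 < t) (hp : 0 ≤ p) (hp1 : p ≤ 1) :
    (1 - Real.exp (-2 * t)) ^ (-p) ≤ 1 + t ^ (-p) := by
  have h1 : Real.exp (-2 * t) ≤ (1 + t)⁻¹ := by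
    rw [neg_mul, Real.exp_neg]
    gcongr
    linarith [Real.add_one_le_exp (2 * t)]
  have h2 : (1 + t⁻¹)⁻¹ ≤ 1 - Real.exp (-2 * t) := by
    refine le_trans (le_of_eq ?_) (sub_le_sub_left h1 1)
    field_simp
    ring
  calc (1 - Real.exp (-2 * t)) ^ (-p) ≤ ((1 + t⁻¹)⁻¹) ^ (-p) :=
        Real.rpow_le_rpow_of_nonpos (by positivity) h2 (by linarith)
    _ = (1 + t⁻¹) ^ p := by
        rw [Real.inv_rpow (by positivity), Real.rpow_neg (by positivity), inv_inv]
    _ ≤ 1 ^ p + t⁻¹ ^ p := Real.rpow_add_le_add_rpow zero_le_one (by positivity) hp hp1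
    _ = 1 + t ^ (-p) := by rw [Real.one_rpow, Real.inv_rpow ht.le, Real.rpow_neg ht.le]

lemma norm_iteratedFDeriv_succ_id_le {d : ℕ} (k : ℕ) (x : E d) :
    ‖iteratedFDeriv ℝ (k + 1) (fun y : E d => y) x‖ ≤ if k = 0 then 1 else 0 := by
  have h : fderiv ℝ (fun y : E d => y) = fun _ => ContinuousLinearMap.id ℝ (E d) :=
    funext fun y => fderiv_fun_id
  rw [← norm_iteratedFDeriv_fderiv, h]
  rcases Nat.eq_zero_or_pos k with rfl | hk
  · simpa using ContinuousLinearMap.norm_id_le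
  · simp [iteratedFDeriv_const_of_ne hk.ne', hk.ne']

lemma norm_iteratedFDeriv_succ_le_add_self {d : ℕ} {s : E d → E d} {k : ℕ}
    (hs : ContDiff ℝ (k + 1 : ℕ) s) (x : E d) :
    ‖iteratedFDeriv ℝ (k + 1) s x‖ ≤
      ‖iteratedFDeriv ℝ (k + 1) (fun y => s y + y) x‖ + if k = 0 then 1 else 0 := by
  have e : iteratedFDeriv ℝ (k + 1) (fun y => s y + y) x =
      iteratedFDeriv ℝ (k + 1) s x + iteratedFDeriv ℝ (k + 1) (fun y : E d => y) x :=
    iteratedFDeriv_add_apply hs.contDiffAt contDiff_id.contDiffAt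
  have h1 := norm_iteratedFDeriv_succ_id_le k x
  have h2 := norm_sub_le (iteratedFDeriv ℝ (k + 1) (fun y => s y + y) x)
    (iteratedFDeriv ℝ (k + 1) (fun y : E d => y) x)
  rw [e, add_sub_cancel_right] at h2
  rw [e]
  linarith

lemma sum_iSup_enorm_le {ι X : Type*} {G : ι → Type*} [∀ i, SeminormedAddCommGroup (G i)]
    (s : Finset ι) (f : ∀ i, X → G i) {A D : ℝ} (hD : s.card * A ≤ D)
    (h : ∀ i ∈ s, ∀ x, ‖f i x‖ ≤ A) :
    ∑ i ∈ s, ⨆ x, ‖f i x‖ₑ ≤ ENNReal.ofReal D := by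
  calc ∑ i ∈ s, ⨆ x, ‖f i x‖ₑ ≤ ∑ _i ∈ s, ENNReal.ofReal A := by
        refine Finset.sum_le_sum fun i hi => iSup_le fun x => ?_
        rw [← ofReal_norm]
        exact ENNReal.ofReal_le_ofReal (h i hi x)
    _ = ENNReal.ofReal (s.card * A) := by
        rw [Finset.sum_const, nsmul_eq_mul, ENNReal.ofReal_mul (Nat.cast_nonneg _),
          ENNReal.ofReal_natCast]
    _ ≤ _ := ENNReal.ofReal_le_ofReal hD

end OUScore

theorem mainTheorem6 (d : ℕ) (hd : 0 < d) (β K : ℝ) (hβ : 1 ≤ β) (hK : 0 < K) :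
    ∃ C : ℝ, 0 < C ∧ ∀ a ∈ OUScore.holderBall d β K, (∫ x, OUScore.target a x) = 1 →
      ∀ t : ℝ, 0 < t →
        ContDiff ℝ (⌊β⌋₊ + 1 : ℕ) (OUScore.score a t) ∧
        (∑ k ∈ Finset.range (⌊β⌋₊ + 1),
            (⨆ x, ‖iteratedFDeriv ℝ k (fun y => OUScore.score a t y + y) x‖ₑ)) ≤
          ENNReal.ofReal (C * Real.exp (-t) * (1 + t ^ (-(1 / 2) : ℝ))) ∧
        (t < 1 →
          (∑ k ∈ Finset.Icc 1 ⌊β⌋₊, (⨆ x, ‖iteratedFDeriv ℝ k (OUScore.score a t) x‖ₑ)) ≤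
            ENNReal.ofReal (C * Real.exp (-t) * (1 + t ^ (-(1 / 2) : ℝ)))) ∧
        (⨆ x, ‖iteratedFDeriv ℝ (⌊β⌋₊ + 1) (OUScore.score a t) x‖ₑ) ≤
          ENNReal.ofReal (C * Real.exp (-t) * (1 + t ^ ((β - ⌊β⌋₊) / 2 - 1))) := by
  obtain ⟨n, α, B, hα, hα1, hB, hnα, hball⟩ :=
    OUScore.exists_holderBounded_of_mem_holderBall hd hβ hK.le
  set m := ⌊β⌋₊ with hm
  have hm1 : 1 ≤ m := Nat.le_floor (by exact_mod_cast hβ)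
  have hmβ : (m : ℝ) ≤ β := Nat.floor_le (by linarith)
  have hβm : β < m + 1 := Nat.lt_floor_add_one β
  obtain ⟨C, hC0, hC⟩ := OUScore.exists_norm_iteratedFDeriv_score_le d n (m + 1) hα hα1 hB
  refine ⟨(m + 1) * (C + Real.exp 1), by positivity, fun a ha _ t ht => ?_⟩
  obtain ⟨hs, hbd⟩ := hC a (hball a ha) t ht
  rw [hnα] at hbd
  have hv : 0 < 1 - Real.exp (-2 * t) := by
    have : Real.exp (-2 * t) < 1 := Real.exp_lt_one_iff.2 (by linarith)
    linarith
  have hv1 : 1 - Real.exp (-2 * t) ≤ 1 := by linarith [Real.exp_pos (-2 * t)]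
  set c := Real.exp (-t) with hc
  have hc0 : 0 < c := Real.exp_pos _
  set R := 1 + t ^ (-(1 / 2) : ℝ) with hR
  have hR1 : 1 ≤ R := le_add_of_nonneg_right (by positivity)
  have hlow : ∀ k ≤ m, ∀ x,
      ‖iteratedFDeriv ℝ k (fun y => OUScore.score a t y + y) x‖ ≤ C * c * R := by
    intro k hk x
    refine (hbd k (by lia) x).trans (mul_le_mul_of_nonneg_left ?_ (by positivity))
    refine le_trans ?_ (OUScore.rpow_neg_one_sub_exp_le ht (p := 1 / 2) (by norm_num) (by norm_num))
    refine Real.rpow_le_rpow_of_exponent_ge hv hv1 ?_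
    have hk' : (k : ℝ) ≤ m := by exact_mod_cast hk
    have : max 0 (((k + 1 : ℕ) : ℝ) - β) ≤ 1 := max_le zero_le_one (by push_cast; linarith)
    linarith
  refine ⟨hs _, ?_, fun ht1 => ?_, ?_⟩
  · refine OUScore.sum_iSup_enorm_le _ _ (A := C * c * R) ?_
      fun k hk => hlow k (Finset.mem_range_succ_iff.1 hk)
    rw [Finset.card_range]
    push_cast
    calc _ = (m + 1) * C * c * R := by ring
      _ ≤ _ := by gcongr; exact le_add_of_nonneg_right (Real.exp_pos 1).le
  · -- The differential of `-x` contributes `1`, which is at most `e · e^{-t}` for `t < 1`.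
    have h1 : 1 ≤ Real.exp 1 * c * R := by
      have h2 : 1 ≤ Real.exp 1 * c := by
        rw [hc, ← Real.exp_add]
        exact Real.one_le_exp (by linarith)
      nlinarith
    refine OUScore.sum_iSup_enorm_le _ _ (A := C * c * R + Real.exp 1 * c * R) ?_ ?_
    · rw [Nat.card_Icc, Nat.add_sub_cancel]
      calc _ = m * (C + Real.exp 1) * c * R := by ring
        _ ≤ _ := by gcongr; linarith
    · intro k hk x
      obtain ⟨h2, h3⟩ := Finset.mem_Icc.1 hk
      obtain ⟨k, rfl⟩ : ∃ k', k = k' + 1 := ⟨k - 1, by lia⟩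
      refine (OUScore.norm_iteratedFDeriv_succ_le_add_self (hs _) x).trans
        (add_le_add (hlow _ h3 x) ?_)
      split_ifs <;> linarith
  · refine iSup_le fun x => ?_
    rw [← ofReal_norm]
    refine ENNReal.ofReal_le_ofReal ?_
    have h1 := OUScore.norm_iteratedFDeriv_succ_le_add_self (hs (m + 1)) x
    rw [if_neg (by lia), add_zero] at h1
    have h2 : OUScore.heatWeight β (1 - Real.exp (-2 * t)) (m + 1 + 1) ≤
        1 + t ^ ((β - m) / 2 - 1) := by
      have h3 := OUScore.rpow_neg_one_sub_exp_le ht (p := 1 - (β - m) / 2) (by linarith)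
        (by linarith)
      rw [neg_sub] at h3
      rw [OUScore.heatWeight, max_eq_right (by push_cast; linarith)]
      convert h3 using 2
      push_cast
      ring
    calc _ ≤ C * c * OUScore.heatWeight β (1 - Real.exp (-2 * t)) (m + 1 + 1) :=
          h1.trans (hbd (m + 1) le_rfl x)
      _ ≤ C * c * (1 + t ^ ((β - m) / 2 - 1)) := by gcongr
      _ ≤ _ := by
        gcongr
        have := Real.exp_pos 1
        have hm0 : (0 : ℝ) ≤ m := Nat.cast_nonneg m
        nlinarith
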